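/- Let $d\ge 2$, $V=\{\pm e_1,\dots,\pm e_d\}$, $V^+=\{e_1,\dots,e_d\}$, and let $\mathcal P$ be the set of probability vectors on $V$. An environment is an element $\omega=(\omega(x,e))_{x\in\mathbb Z^d,e\in V}$ of $\Omega=\mathcal P^{\mathbb Z^d}$ (with its product $\sigma$-algebra), and $P_{x,\omega}$ is the law of the Markov chain $(X_n)_{n\ge 0}$ on $\mathbb Z^d$ with $X_0=x$ and $P_{x,\omega}(X_{n+1}=y+e\mid X_n=y)=\omega(y,e)$. Let $\mathbb P$ be a probability measure on $\Omega$ such that (i) the random vectors $\omega(x,\cdot)$, $x\in\mathbb Z^d$, are i.i.d. under $\mathbb P$; (ii) there is $\kappa>0$ with $\mathbb P(\omega(x,e)\ge\kappa)=1$ for all $x\in\mathbb Z^d$ and $e\in V$. Let $\partial R_n=\{x\in\mathbb Z^d: |x|_1=n,\ x_j\ge 0 \text{ for all } j\}$, $\mathcal A_n=\{X_n-X_0\in\partial R_n\}$, $J_1=1$ and, for $n\ge 2$, $J_n(\omega)=\max_{x\in\mathbb Z^d}P_{0,\omega}(X_{n-1}=x\mid\mathcal A_{n-1})$. The walk is *localized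 at the boundary* if $\liminf_{n\to\infty}\frac1n\sum_{k=1}^nJ_k>0$ $\mathbb P$-a.s., and *delocalized at the boundary* if $\liminf_{n\to\infty}\frac1n\sum_{k=1}^nJ_k=0$ $\mathbb P$-a.s. Let $c=\sum_{e\in V^+}\mathbb E[\omega(0,e)]$, $\Psi(\omega,x)=\log\sum_{e\in V^+}\omega(x,e)$ and $\pi(\omega,x,e)=\omega(x,e)/\sum_{e'\in V^+}\omega(x,e')$ for $e\in V^+$, and let $E_{0,\pi}$ be the expectation for the walk started at $0$ with jumps in $V^+$ and transition probabilities $\pi(\omega,\cdot,\cdot)$. Then there are real numbers $p$ and $\lambda$ (the quenched and annealed free energies) such that $$p=\lim_{n\to\infty}\frac1n\log E_{0,\pi}\Big(e^{\sum_{i=0}^{n-1}\Psi(\omega,X_i)}\Big)\quad\text{for }\mathbb P\text{-a.e. }\omega,\qquad \lambda=\lim_{n\to\infty}\frac1n\log\mathbb E\,E_{0,\pi}\Big(e^{\sum_{i=0}^{n-1}\Psi(\omega,X_i)}\Big)=\log c,$$ and 1. the walk is localized at the boundary if and only if $p<\lambda$; 2. the walk is delocalized at the boundary if and only if $p=\lambda$.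 In particular, the walk is either localized or delocalized at the boundary (exactly one of the two holds). -/

import Mathlib

open MeasureTheory ProbabilityTheory Filter Topology

noncomputable section

namespace RWRE

/-- The lattice `ℤ^d`. -/
abbrev Site (d : ℕ) : Type := Fin d → ℤ

/-- Labels of the `2d` nearest-neighbour jumps: `(i, s)` with `s = ±1` stands for `s • e_i`. -/
abbrev Dir (d : ℕ) : Type := Fin d × ℤˣ

/-- The lattice vector `s • e_i` labelled by `(i, s)`. -/
def jump {d : ℕ} (e : Dir d) : Site d := Pi.single e.1 (e.2 : ℤ)

/-- The labels faithfully enumerate unit vectors. -/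
lemma jump_injective {d : ℕ} : Function.Injective (jump (d := d)) := by
  rintro ⟨i, s⟩ ⟨j, t⟩ h
  have h1 := congrFun h i
  by_cases hij : i = j
  · subst hij
    simp only [jump, Pi.single_eq_same] at h1
    rw [Units.ext h1]
  · simp [jump, Pi.single_eq_of_ne hij] at h1

/-- The jumps are exactly the lattice vectors of `ℓ¹` norm one. -/
lemma range_jump {d : ℕ} : Set.range (jump (d := d)) = {x : Site d | ∑ i, |x i| = 1} := by
  ext x
  simp only [Set.mem_range, Set.mem_ofPred_eq]
  constructor
  · rintro ⟨⟨i, s⟩, rfl⟩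
    rw [Finset.sum_eq_single i]
    · rcases Int.units_eq_one_or s with rfl | rfl <;> simp [jump]
    · intro j _ hj
      simp [jump, Pi.single_eq_of_ne hj]
    · simp
  · intro hx
    obtain ⟨i, hi⟩ : ∃ i, x i ≠ 0 := by
      by_contra! hcon
      simp [hcon] at hx
    have hsplit := Finset.add_sum_erase Finset.univ (fun j => |x j|) (Finset.mem_univ i)
    have hpos : 0 < |x i| := abs_pos.mpr hi
    have hrest : 0 ≤ ∑ j ∈ Finset.univ.erase i, |x j| :=
      Finset.sum_nonneg fun j _ => abs_nonneg _
    have hone : |x i| = 1 := by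
      omega
    have hzero : ∑ j ∈ Finset.univ.erase i, |x j| = 0 := by
      omega
    have hoff : ∀ j, j ≠ i → x j = 0 := fun j hj =>
      abs_eq_zero.mp ((Finset.sum_eq_zero_iff_of_nonneg fun j _ => abs_nonneg (x j)).mp hzero j
        (Finset.mem_erase.mpr ⟨hj, Finset.mem_univ j⟩))
    obtain ⟨s, hs⟩ : ∃ s : ℤˣ, (s : ℤ) = x i := by
      have : IsUnit (x i) := Int.isUnit_iff.mpr (by
        rcases abs_cases (x i) with h | h <;> omega)
      exact ⟨this.unit, rfl⟩
    refine ⟨(i, s), ?_⟩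
    funext j
    by_cases hj : j = i
    · subst hj; simp [jump, hs]
    · simp [jump, Pi.single_eq_of_ne hj, hoff j hj]

/-- Nearest-neighbour probability vectors. -/
abbrev ProbVec (d : ℕ) : Type := stdSimplex ℝ (Dir d)

/-- The space of environments, with the product (Borel) σ-algebra; `ω x e` is `ω(x,e)`. -/
abbrev Env (d : ℕ) : Type := Site d → ProbVec d

variable {d : ℕ}

/-- The probability `ω(x,e)` of the jump `e` at the site `x`. -/
def prob (ω : Env d) (x : Site d) (e : Dir d) : ℝ := (ω x : Dir d → ℝ) e

/-- The law of the next position of the walk in environment `ω` when it stands at `y`. -/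
def stepMeasure (ω : Env d) (y : Site d) : Measure (Site d) :=
  ∑ e : Dir d, ENNReal.ofReal (prob ω y e) • Measure.dirac (y + jump e)

instance (ω : Env d) (y : Site d) : IsProbabilityMeasure (stepMeasure ω y) := by
  constructor
  have h : ∑ e : Dir d, ENNReal.ofReal (prob ω y e) = 1 := by
    rw [← ENNReal.ofReal_sum_of_nonneg (f := prob ω y) fun e _ => (ω y).2.1 e]
    have h1 : ∑ e : Dir d, prob ω y e = 1 := (ω y).2.2
    rw [h1, ENNReal.ofReal_one]
  simpa [stepMeasure] using h

/-- One-step transition kernel of the walk in environment `ω`. -/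
def stepKernel (ω : Env d) : Kernel (Site d) (Site d) :=
  Kernel.ofFunOfCountable (stepMeasure ω)

instance (ω : Env d) : IsMarkovKernel (stepKernel ω) :=
  ⟨fun y => inferInstanceAs (IsProbabilityMeasure (stepMeasure ω y))⟩

/-- The same transition, as a kernel from the history `(X_0, …, X_n)` to `X_{n+1}`;
it depends on the history through `X_n` only. -/
def histKernel (ω : Env d) (n : ℕ) : Kernel (Π _ : Finset.Iic n, Site d) (Site d) :=
  (stepKernel ω).comap (fun h => h ⟨n, Finset.mem_Iic.mpr le_rfl⟩) (measurable_pi_apply _)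

instance (ω : Env d) (n : ℕ) : IsMarkovKernel (histKernel ω n) := by
  unfold histKernel; infer_instance

/-- The quenched law `P_{x,ω}` on trajectories: the law of the Markov chain started at `x`
with transition probabilities `ω(y,e)` from `y` to `y + e`. -/
def quenched (ω : Env d) (x : Site d) : Measure (ℕ → Site d) :=
  Kernel.traj (X := fun _ => Site d) (histKernel ω) 0 (fun _ => x)

instance (ω : Env d) (x : Site d) : IsProbabilityMeasure (quenched ω x) := by
  unfold quenched; infer_instance

/-- The random vectors `ω(x,·)`, `x ∈ ℤ^d`, are i.i.d. under `μ`. -/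
def IsIID (μ : Measure (Env d)) : Prop :=
  iIndepFun (fun (x : Site d) (ω : Env d) => ω x) μ ∧
    ∀ x y : Site d, IdentDistrib (fun ω : Env d => ω x) (fun ω : Env d => ω y) μ μ

/-- Uniform ellipticity. -/
def UniformlyElliptic (μ : Measure (Env d)) : Prop :=
  ∃ κ : ℝ, 0 < κ ∧ ∀ (x : Site d) (e : Dir d), ∀ᵐ ω ∂μ, κ ≤ prob ω x e

/-- The averaged jump probability `q(e) = 𝔼[ω(0,e)]`. -/
def q (μ : Measure (Env d)) (e : Dir d) : ℝ := ∫ ω, prob ω 0 e ∂μ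

/-- `c = ∑_{e ∈ V⁺} q(e)`, where `V⁺ = {e_1, …, e_d}`. -/
def c (μ : Measure (Env d)) : ℝ := ∑ i : Fin d, q μ (i, 1)

/-- `∂R_n`: the points of `ℤ^d` with nonnegative coordinates and `ℓ¹` norm `n`. -/
def bdry (d n : ℕ) : Set (Site d) := {x | ∑ i, |x i| = (n : ℤ) ∧ ∀ j, 0 ≤ x j}

/-- The event `A_n = {X_n - X_0 ∈ ∂R_n}`. -/
def bdryEvent (d n : ℕ) : Set (ℕ → Site d) := {X | X n - X 0 ∈ bdry d n}

/-- `J_1 = 1` and `J_n = max_x P_{0,ω}(X_{n-1} = x | A_{n-1})` for `n ≥ 2`. -/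
def J (ω : Env d) (n : ℕ) : ℝ :=
  if n ≤ 1 then 1
  else ⨆ x : Site d, (cond (quenched ω 0) (bdryEvent d (n - 1))).real {X | X (n - 1) = x}

/-- `liminf_n (1/n) ∑_{k=1}^n J_k` -/
def liminfJ (ω : Env d) : ℝ :=
  liminf (fun n : ℕ => (1 / (n : ℝ)) * ∑ k ∈ Finset.Icc 1 n, J ω k) atTop

/-- Localization at the boundary. -/
def Localized (μ : Measure (Env d)) : Prop := ∀ᵐ ω ∂μ, 0 < liminfJ ω

/-- Delocalization at the boundary. -/
def Delocalized (μ : Measure (Env d)) : Prop := ∀ᵐ ω ∂μ, liminfJ ω = 0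

/-- The total weight `∑_{e ∈ V⁺} ω(x,e)` of the positive jumps at `x`. -/
def posWeight (ω : Env d) (x : Site d) : ℝ := ∑ i : Fin d, prob ω x (i, 1)

/-- The potential `Ψ(ω,x) = log ∑_{e ∈ V⁺} ω(x,e)`. -/
def Psi (ω : Env d) (x : Site d) : ℝ := Real.log (posWeight ω x)

open Classical in
/-- The environment `π(ω,x,e) = ω(x,e) / ∑_{e' ∈ V⁺} ω(x,e')` for `e ∈ V⁺`, with no mass outside
`V⁺`. Where the positive jumps have total weight zero (a null event under uniform ellipticity,
`d ≥ 1`) the quotient is meaningless and `ω(x,·)` is left unchanged. -/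
def piEnv (ω : Env d) : Env d := fun x =>
  if h : 0 < posWeight ω x then
    ⟨fun e => if e.2 = 1 then prob ω x e / posWeight ω x else 0, by
      constructor
      · intro e
        dsimp only
        split_ifs
        · exact div_nonneg ((ω x).2.1 e) h.le
        · exact le_rfl
      · rw [Fintype.sum_prod_type_right, Finset.sum_eq_single (1 : ℤˣ)]
        · simp only [if_true]
          rw [← Finset.sum_div]
          exact div_self h.ne'
        · intro s _ hs
          simp [hs]
        · simp⟩
  else ω x

/-- The partition function `E_{0,π}[exp (∑_{i<n} Ψ(ω,X_i))]`. -/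
def Z (ω : Env d) (n : ℕ) : ℝ :=
  ∫ X, Real.exp (∑ i ∈ Finset.range n, Psi ω (X i)) ∂(quenched (piEnv ω) 0)

/-- `p` is the (deterministic) quenched free energy: almost surely,
`(1/n) log E_{0,π}[exp (∑_{i<n} Ψ(ω,X_i))] → p`. -/
def IsQuenchedFreeEnergy (μ : Measure (Env d)) (p : ℝ) : Prop :=
  ∀ᵐ ω ∂μ, Tendsto (fun n : ℕ => (1 / (n : ℝ)) * Real.log (Z ω n)) atTop (𝓝 p)

/-- `l` is the annealed free energy: `(1/n) log 𝔼 E_{0,π}[exp (∑_{i<n} Ψ(ω,X_i))] → l`. -/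
def IsAnnealedFreeEnergy (μ : Measure (Env d)) (l : ℝ) : Prop :=
  Tendsto (fun n : ℕ => (1 / (n : ℝ)) * Real.log (∫ ω, Z ω n ∂μ)) atTop (𝓝 l)

end RWRE

end

open MeasureTheory ProbabilityTheory Filter Topology

noncomputable section

namespace RWRE

/-! ### Directed polymers with weights in `[κ, 1]`: paths, partition functions, endpoint laws -/

variable {d : ℕ} {κ : ℝ}

/-! A nearest-neighbour step raises the coordinate sum (the level) by at most one, so lying in ∂R_n
at time n forces every step to be positive. Given A_n the walk is thus a directed polymer whose
paths are weighted by products of ω(x,e): its endpoint law is `endpoint`, J_{n+1} is the largest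
endpoint mass (`cond_quenched_eq_endpoint`), and since e^Ψ π = ω on V⁺, the given partition function
is that of the polymer (`Z_eq_partition`). Ellipticity allows the weights to be truncated to `[κ,
1]` off a null set, which leaves an i.i.d. field.

The mean of log Z_n is superadditive by Jensen and the independence of disjoint ranges of levels.
Changing one level moves log Z_n by a bounded amount, so its variance is O(n) and the convergence is
almost sure (`exists_freeEnergy`). The annealed energy is exact, because Z_n has mean c^n.

The ratio Z_{n+1}/Z_n averages, under the endpoint law, the total weights on level n, which are
independent of that law. Given the lower levels it has mean c and variance σ² I_n, where σ² is the
variance of a total weight and I_n the replica overlap. A second-order expansion of log makes the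
gap between log c and the conditional mean of log(Z_{n+1}/Z_n) comparable to σ² I_n, and the law of
large numbers for martingale differences identifies λ - p with the limit of the averaged gaps. If p
< λ, the averaged overlaps stay away from zero, and the overlap is at most the maximal mass. If p =
λ and σ² > 0, the averaged overlaps vanish, and so do the averaged maxima, since the squared maximum
is at most the overlap.

If σ² = 0 the gap carries no information on the overlap. Then take two replicas in the same
environment: after averaging over the environment, a coordinate of their difference is a martingale
with increments of modulus at most 1, so its mean modulus is at most √n. As d ≥ 2, that mean modulus
gains at least (κ²/c²) 𝔼 I_n at step n. Hence ∑_{k<n} 𝔼 I_k = O(√n), the averaged overlaps tend to 0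
in L¹, and almost surely along a subsequence, which is enough for a liminf.

Since p ≤ λ, and the two regimes exclude each other, these two implications yield both equivalences
and the dichotomy. -/

/-- Directed-polymer weights at one site, bounded between `κ` and `1`. -/
abbrev WeightVec (d : ℕ) (κ : ℝ) : Type := {v : Fin d → ℝ // ∀ i, κ ≤ v i ∧ v i ≤ 1}

/-- Fields of directed-polymer weights. -/
abbrev Field (d : ℕ) (κ : ℝ) : Type := Site d → WeightVec d κ

/-- The lattice vector `e_i`. -/
def unitVec (i : Fin d) : Site d := Pi.single i 1

/-- The sum of the coordinates of a site. -/
def level (x : Site d) : ℤ := ∑ i, x i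

@[simp] lemma level_unitVec (i : Fin d) : level (unitVec i) = 1 := by
  simp [level, unitVec]

@[simp] lemma level_add (x y : Site d) : level (x + y) = level x + level y := by
  simp [level, Finset.sum_add_distrib]

@[simp] lemma level_sub (x y : Site d) : level (x - y) = level x - level y := by
  simp [level, Finset.sum_sub_distrib]

@[simp] lemma level_zero : level (0 : Site d) = 0 := by
  simp [level]

lemma unitVec_nonneg (i : Fin d) : 0 ≤ unitVec i := by
  simp [unitVec, Pi.single_nonneg]

/-- The sites with nonnegative coordinates that sum to `n`. -/
def orthant (d n : ℕ) : Finset (Site d) :=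
  (Finset.Icc (0 : Site d) (fun _ => (n : ℤ))).filter (fun x => level x = n)

lemma mem_orthant {n : ℕ} {x : Site d} : x ∈ orthant d n ↔ 0 ≤ x ∧ level x = n := by
  simp only [orthant, Finset.mem_filter, Finset.mem_Icc]
  refine ⟨fun h => ⟨h.1.1, h.2⟩, fun h => ⟨⟨h.1, fun i => ?_⟩, h.2⟩⟩
  rw [← h.2]
  exact Finset.single_le_sum (f := x) (fun j _ => h.1 j) (Finset.mem_univ i)

lemma mem_orthant_iff_mem_bdry {n : ℕ} {x : Site d} : x ∈ orthant d n ↔ x ∈ bdry d n := by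
  rw [mem_orthant]
  constructor
  · rintro ⟨h0, h⟩
    refine ⟨?_, h0⟩
    rw [← h]
    exact Finset.sum_congr rfl fun i _ => abs_of_nonneg (h0 i)
  · rintro ⟨h, h0⟩
    refine ⟨h0, ?_⟩
    rw [← h]
    exact Finset.sum_congr rfl fun i _ => (abs_of_nonneg (h0 i)).symm

@[simp] lemma orthant_zero : orthant d 0 = {0} := by
  ext x
  rw [mem_orthant, Finset.mem_singleton]
  constructor
  · rintro ⟨h0, h⟩
    funext i
    exact (Finset.sum_eq_zero_iff_of_nonneg (fun j _ => h0 j)).mp h i (Finset.mem_univ i)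
  · rintro rfl
    simp

/-- The total weight of directed paths of length `n` from the origin to a given site. -/
def mass (ω : Field d κ) : ℕ → Site d → ℝ
  | 0 => Pi.single 0 1
  | n + 1 => fun y => ∑ i, mass ω n (y - unitVec i) * (ω (y - unitVec i)).1 i

lemma mass_eq_zero (ω : Field d κ) {n : ℕ} {x : Site d} (hx : x ∉ orthant d n) :
    mass ω n x = 0 := by
  induction n generalizing x with
  | zero =>
    simp only [orthant_zero, Finset.mem_singleton] at hx
    simp [mass, hx]
  | succ n ih =>
    refine Finset.sum_eq_zero fun i _ => ?_
    rw [ih, zero_mul]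
    contrapose! hx
    rw [mem_orthant] at hx ⊢
    have h := add_nonneg hx.1 (unitVec_nonneg i)
    rw [sub_add_cancel] at h
    refine ⟨h, ?_⟩
    have := hx.2
    rw [level_sub, level_unitVec] at this
    push_cast
    linarith

/-- Reindexes the last edge by its starting point; a site without a predecessor in the orthant
carries no mass. The test function `f` lets one identity serve partition functions, endpoint
averages and pairs of replicas. -/
lemma sum_mass_succ (ω : Field d κ) (n : ℕ) (f : Site d → ℝ) :
    ∑ y ∈ orthant d (n + 1), mass ω (n + 1) y * f y =
      ∑ x ∈ orthant d n, mass ω n x * ∑ i, (ω x).1 i * f (x + unitVec i) := by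
  simp only [mass, Finset.sum_mul, Finset.mul_sum]
  rw [Finset.sum_comm, Finset.sum_comm (s := orthant d n)]
  refine Finset.sum_congr rfl fun i _ => ?_
  symm
  refine Finset.sum_of_injOn (· + unitVec i) (fun _ _ _ _ h => add_right_cancel h) ?_ ?_ ?_
  · intro x hx
    simp only [Finset.mem_coe, mem_orthant] at hx ⊢
    refine ⟨add_nonneg hx.1 (unitVec_nonneg i), ?_⟩
    simp [hx.2]
  · intro y _ hy
    rw [mass_eq_zero, zero_mul, zero_mul]
    exact fun h => hy ⟨y - unitVec i, h, sub_add_cancel _ _⟩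
  · intro x _
    simp [mul_assoc]

/-- The partition function of the directed polymer. -/
def partition (ω : Field d κ) (n : ℕ) : ℝ := ∑ x ∈ orthant d n, mass ω n x

/-- The total weight of the steps out of a site. -/
def rowSum (s : WeightVec d κ) : ℝ := ∑ i, s.1 i

lemma partition_zero (ω : Field d κ) : partition ω 0 = 1 := by
  simp [partition, mass]

lemma partition_succ (ω : Field d κ) (n : ℕ) :
    partition ω (n + 1) = ∑ x ∈ orthant d n, mass ω n x * rowSum (ω x) := by
  have := sum_mass_succ ω n (fun _ => 1)
  simpa [partition, rowSum] using this

lemma mass_nonneg (hκ : 0 < κ) (ω : Field d κ) (n : ℕ) (x : Site d) : 0 ≤ mass ω n x := by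
  induction n generalizing x with
  | zero =>
    simp only [mass, Pi.single_apply]
    split_ifs <;> norm_num
  | succ n ih =>
    exact Finset.sum_nonneg fun i _ => mul_nonneg (ih _) (hκ.le.trans ((ω _).2 i).1)

lemma le_rowSum (hd : 0 < d) (hκ : 0 < κ) (s : WeightVec d κ) : κ ≤ rowSum s := by
  have := Finset.single_le_sum (f := s.1) (fun i _ => hκ.le.trans (s.2 i).1)
    (Finset.mem_univ ⟨0, hd⟩)
  exact (s.2 _).1.trans this

lemma rowSum_le (s : WeightVec d κ) : rowSum s ≤ d := by
  have := Finset.sum_le_sum (s := Finset.univ) (fun i _ => (s.2 i).2)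
  simpa [rowSum] using this

lemma partition_pos (hd : 0 < d) (hκ : 0 < κ) (ω : Field d κ) (n : ℕ) : 0 < partition ω n := by
  induction n with
  | zero => simp [partition_zero]
  | succ n ih =>
    rw [partition_succ]
    refine lt_of_lt_of_le (mul_pos ih hκ) ?_
    rw [partition, Finset.sum_mul]
    exact Finset.sum_le_sum fun x _ =>
      mul_le_mul_of_nonneg_left (le_rowSum hd hκ _) (mass_nonneg hκ _ _ _)

/-- The endpoint distribution of the directed polymer of length `n`. -/
def endpoint (ω : Field d κ) (n : ℕ) (x : Site d) : ℝ := mass ω n x / partition ω n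

lemma endpoint_nonneg (hd : 0 < d) (hκ : 0 < κ) (ω : Field d κ) (n : ℕ) (x : Site d) :
    0 ≤ endpoint ω n x :=
  div_nonneg (mass_nonneg hκ _ _ _) (partition_pos hd hκ _ _).le

lemma sum_endpoint (hd : 0 < d) (hκ : 0 < κ) (ω : Field d κ) (n : ℕ) :
    ∑ x ∈ orthant d n, endpoint ω n x = 1 := by
  simp only [endpoint]
  rw [← Finset.sum_div]
  exact div_self (partition_pos hd hκ _ _).ne'

lemma endpoint_le_one (hd : 0 < d) (hκ : 0 < κ) (ω : Field d κ) (n : ℕ) (x : Site d) :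
    endpoint ω n x ≤ 1 := by
  by_cases hx : x ∈ orthant d n
  · rw [← sum_endpoint hd hκ ω n]
    exact Finset.single_le_sum (fun y _ => endpoint_nonneg hd hκ ω n y) hx
  · simp [endpoint, mass_eq_zero ω hx]

/-- The mean of the total outgoing weight in the field `ω'` under the endpoint distribution
in the field `ω`. -/
def growth (ω ω' : Field d κ) (n : ℕ) : ℝ := ∑ x ∈ orthant d n, endpoint ω n x * rowSum (ω' x)

/-- Turns log Z_n into a sum of increments, each between log κ and log d. -/
lemma partition_succ_eq_mul_growth (hd : 0 < d) (hκ : 0 < κ) (ω : Field d κ) (n : ℕ) :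
    partition ω (n + 1) = partition ω n * growth ω ω n := by
  rw [partition_succ, growth, Finset.mul_sum]
  refine Finset.sum_congr rfl fun x _ => ?_
  have := (partition_pos hd hκ ω n).ne'
  rw [endpoint]
  field_simp

lemma le_growth (hd : 0 < d) (hκ : 0 < κ) (ω ω' : Field d κ) (n : ℕ) : κ ≤ growth ω ω' n := by
  calc κ = ∑ x ∈ orthant d n, endpoint ω n x * κ := by
        rw [← Finset.sum_mul, sum_endpoint hd hκ ω n, one_mul]
    _ ≤ _ := Finset.sum_le_sum fun x _ =>
        mul_le_mul_of_nonneg_left (le_rowSum hd hκ _) (endpoint_nonneg hd hκ _ _ _)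

lemma growth_le (hd : 0 < d) (hκ : 0 < κ) (ω ω' : Field d κ) (n : ℕ) : growth ω ω' n ≤ d := by
  calc growth ω ω' n ≤ ∑ x ∈ orthant d n, endpoint ω n x * d := Finset.sum_le_sum fun x _ =>
        mul_le_mul_of_nonneg_left (rowSum_le _) (endpoint_nonneg hd hκ _ _ _)
    _ = d := by rw [← Finset.sum_mul, sum_endpoint hd hκ ω n, one_mul]

/-- A bound for `|log t|` on `[κ, d]`. -/
def logBound (d : ℕ) (κ : ℝ) : ℝ := |Real.log κ| + |Real.log d|

lemma logBound_nonneg : 0 ≤ logBound d κ := by unfold logBound; positivity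

lemma abs_log_le_logBound (hκ : 0 < κ) {t : ℝ} (h1 : κ ≤ t) (h2 : t ≤ d) :
    |Real.log t| ≤ logBound d κ := by
  have ht : 0 < t := hκ.trans_le h1
  have h3 := Real.log_le_log hκ h1
  have h4 := Real.log_le_log ht h2
  rw [abs_le, logBound]
  constructor <;> linarith [neg_abs_le (Real.log κ), le_abs_self (Real.log d),
    abs_nonneg (Real.log κ), abs_nonneg (Real.log d)]

lemma abs_log_growth_le (hd : 0 < d) (hκ : 0 < κ) (ω ω' : Field d κ) (n : ℕ) :
    |Real.log (growth ω ω' n)| ≤ logBound d κ :=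
  abs_log_le_logBound hκ (le_growth hd hκ _ _ _) (growth_le hd hκ _ _ _)

lemma log_partition_succ (hd : 0 < d) (hκ : 0 < κ) (ω : Field d κ) (n : ℕ) :
    Real.log (partition ω (n + 1)) = Real.log (partition ω n) + Real.log (growth ω ω n) := by
  rw [partition_succ_eq_mul_growth hd hκ, Real.log_mul (partition_pos hd hκ _ _).ne'
    (hκ.trans_le (le_growth hd hκ _ _ _)).ne']

lemma log_partition_eq_sum (hd : 0 < d) (hκ : 0 < κ) (ω : Field d κ) (n : ℕ) :
    Real.log (partition ω n) = ∑ k ∈ Finset.range n, Real.log (growth ω ω k) := by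
  induction n with
  | zero => simp [partition_zero]
  | succ n ih => rw [log_partition_succ hd hκ, ih, Finset.sum_range_succ]

lemma abs_log_partition_le (hd : 0 < d) (hκ : 0 < κ) (ω : Field d κ) (n : ℕ) :
    |Real.log (partition ω n)| ≤ n * logBound d κ := by
  rw [log_partition_eq_sum hd hκ]
  refine (Finset.abs_sum_le_sum_abs _ _).trans ?_
  refine (Finset.sum_le_sum fun k _ => abs_log_growth_le hd hκ ω ω k).trans ?_
  simp

/-! ### Cutting paths at a level, and dependence on the levels -/

/-- The field seen from the site `x`. -/
def shift (x : Site d) (ω : Field d κ) : Field d κ := fun y => ω (x + y)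

/-- Cuts each path at level `n`. Allowing every test function makes the induction on `m` close
through `sum_mass_succ`. -/
lemma sum_mass_add (ω : Field d κ) (n m : ℕ) (f : Site d → ℝ) :
    ∑ y ∈ orthant d (n + m), mass ω (n + m) y * f y =
      ∑ x ∈ orthant d n, mass ω n x *
        ∑ z ∈ orthant d m, mass (shift x ω) m z * f (x + z) := by
  induction m generalizing f with
  | zero => simp [mass]
  | succ m ih =>
    rw [← add_assoc, sum_mass_succ, ih]
    refine Finset.sum_congr rfl fun x _ => ?_
    rw [sum_mass_succ (shift x ω) m]
    simp [shift, add_assoc]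

lemma partition_add (ω : Field d κ) (n m : ℕ) :
    partition ω (n + m) = ∑ x ∈ orthant d n, mass ω n x * partition (shift x ω) m := by
  simpa [partition] using sum_mass_add ω n m (fun _ => 1)

/-- A directed path of length `n` reads only the weights on levels 0, …, n - 1. All later
independence statements rest on this. -/
lemma mass_congr {ω ω' : Field d κ} {n : ℕ}
    (h : ∀ x, 0 ≤ level x → level x < n → ω x = ω' x) (y : Site d) : mass ω n y = mass ω' n y := by
  induction n generalizing y with
  | zero => rfl
  | succ n ih =>
    refine Finset.sum_congr rfl fun i _ => ?_
    by_cases hy : y - unitVec i ∈ orthant d n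
    · have hl := (mem_orthant.mp hy).2
      rw [ih fun x h0 hx => h x h0 (by push_cast; linarith), h] <;> rw [hl]
      · exact Int.natCast_nonneg n
      · push_cast
        linarith
    · simp [mass_eq_zero _ hy]

/-- A directed path leaves level `k` at most once, so altering that level changes one factor, which
lies in `[κ, 1]` in both fields. -/
lemma mass_le_of_eq_off_level (hκ : 0 < κ) {ω ω' : Field d κ} {k : ℕ}
    (h : ∀ x, level x ≠ k → ω x = ω' x) (n : ℕ) (y : Site d) :
    mass ω n y ≤ max 1 κ⁻¹ * mass ω' n y := by
  have hstep : ∀ n, n ≤ k → ∀ y, mass ω n y = mass ω' n y := fun n hn y =>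
    mass_congr (fun x _ hx => h x (by
      have : (n : ℤ) ≤ k := by exact_mod_cast hn
      exact (hx.trans_le this).ne)) y
  have hK : 1 ≤ max 1 κ⁻¹ := le_max_left _ _
  induction n generalizing y with
  | zero =>
    rw [hstep 0 (Nat.zero_le _)]
    exact le_mul_of_one_le_left (mass_nonneg hκ _ _ _) hK
  | succ n ih =>
    rw [mass, mass, Finset.mul_sum]
    refine Finset.sum_le_sum fun i _ => ?_
    by_cases hy : y - unitVec i ∈ orthant d n
    · by_cases hnk : n = k
      · subst hnk
        rw [hstep n le_rfl, mul_left_comm]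
        refine mul_le_mul_of_nonneg_left ?_ (mass_nonneg hκ _ _ _)
        refine ((ω _).2 i).2.trans ?_
        calc (1 : ℝ) = κ⁻¹ * κ := (inv_mul_cancel₀ hκ.ne').symm
          _ ≤ _ := mul_le_mul (le_max_right _ _) ((ω' _).2 i).1 hκ.le (by positivity)
      · rw [h _ (by rw [(mem_orthant.mp hy).2]; exact_mod_cast hnk), ← mul_assoc]
        exact mul_le_mul_of_nonneg_right (ih _) (hκ.le.trans ((ω' _).2 i).1)
    · simp [mass_eq_zero _ hy]

lemma partition_congr {ω ω' : Field d κ} {n : ℕ}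
    (h : ∀ x, 0 ≤ level x → level x < n → ω x = ω' x) :
    partition ω n = partition ω' n :=
  Finset.sum_congr rfl fun x _ => mass_congr h x

lemma endpoint_congr {ω ω' : Field d κ} {n : ℕ}
    (h : ∀ x, 0 ≤ level x → level x < n → ω x = ω' x)
    (y : Site d) : endpoint ω n y = endpoint ω' n y := by
  rw [endpoint, endpoint, mass_congr h, partition_congr h]

lemma growth_congr {ω₁ ω₂ ω₁' ω₂' : Field d κ} {n : ℕ}
    (h : ∀ x, 0 ≤ level x → level x < n → ω₁ x = ω₂ x)
    (h' : ∀ x, level x = n → ω₁' x = ω₂' x) : growth ω₁ ω₁' n = growth ω₂ ω₂' n :=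
  Finset.sum_congr rfl fun x hx => by
    rw [endpoint_congr h, h' x (mem_orthant.mp hx).2]

lemma abs_log_partition_sub_le (hd : 0 < d) (hκ : 0 < κ) {ω ω' : Field d κ} {k : ℕ}
    (h : ∀ x, level x ≠ k → ω x = ω' x) (n : ℕ) :
    |Real.log (partition ω n) - Real.log (partition ω' n)| ≤ Real.log (max 1 κ⁻¹) := by
  have key : ∀ {ω ω' : Field d κ}, (∀ x, level x ≠ k → ω x = ω' x) →
      Real.log (partition ω n) ≤ Real.log (max 1 κ⁻¹) + Real.log (partition ω' n) := by
    intro ω ω' h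
    rw [← Real.log_mul (by positivity) (partition_pos hd hκ _ _).ne']
    refine Real.log_le_log (partition_pos hd hκ _ _) ?_
    rw [partition, partition, Finset.mul_sum]
    exact Finset.sum_le_sum fun x _ => mass_le_of_eq_off_level hκ h n x
  have h1 := key h
  have h2 := key fun x hx => (h x hx).symm
  rw [abs_le]
  constructor <;> linarith

/-! ### Replica overlap and maximal endpoint mass -/

/-- The sum of the squares of the endpoint probabilities. -/
def replicaOverlap (ω : Field d κ) (n : ℕ) : ℝ := ∑ x ∈ orthant d n, endpoint ω n x ^ 2

/-- The largest endpoint probability. -/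
def maxEndpoint (ω : Field d κ) (n : ℕ) : ℝ := ⨆ x, endpoint ω n x

lemma bddAbove_endpoint (hd : 0 < d) (hκ : 0 < κ) (ω : Field d κ) (n : ℕ) :
    BddAbove (Set.range (endpoint ω n)) :=
  ⟨1, by rintro _ ⟨x, rfl⟩; exact endpoint_le_one hd hκ ω n x⟩

lemma endpoint_le_maxEndpoint (hd : 0 < d) (hκ : 0 < κ) (ω : Field d κ) (n : ℕ) (x : Site d) :
    endpoint ω n x ≤ maxEndpoint ω n :=
  le_ciSup (bddAbove_endpoint hd hκ ω n) x

lemma maxEndpoint_nonneg (hd : 0 < d) (hκ : 0 < κ) (ω : Field d κ) (n : ℕ) :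
    0 ≤ maxEndpoint ω n :=
  (endpoint_nonneg hd hκ ω n 0).trans (endpoint_le_maxEndpoint hd hκ ω n 0)

lemma maxEndpoint_le_one (hd : 0 < d) (hκ : 0 < κ) (ω : Field d κ) (n : ℕ) :
    maxEndpoint ω n ≤ 1 :=
  ciSup_le fun x => endpoint_le_one hd hκ ω n x

lemma replicaOverlap_nonneg (ω : Field d κ) (n : ℕ) : 0 ≤ replicaOverlap ω n :=
  Finset.sum_nonneg fun _ _ => sq_nonneg _

lemma replicaOverlap_le_maxEndpoint (hd : 0 < d) (hκ : 0 < κ) (ω : Field d κ) (n : ℕ) :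
    replicaOverlap ω n ≤ maxEndpoint ω n := by
  rw [← mul_one (maxEndpoint ω n), ← sum_endpoint hd hκ ω n, Finset.mul_sum]
  refine Finset.sum_le_sum fun x _ => ?_
  rw [sq]
  exact mul_le_mul_of_nonneg_right (endpoint_le_maxEndpoint hd hκ ω n x)
    (endpoint_nonneg hd hκ ω n x)

lemma maxEndpoint_sq_le (hd : 0 < d) (hκ : 0 < κ) (ω : Field d κ) (n : ℕ) :
    maxEndpoint ω n ^ 2 ≤ replicaOverlap ω n := by
  -- This form needs a positive maximum; otherwise all endpoint masses vanish, although they sum to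
  -- 1.
  rw [← Real.le_sqrt' ?_]
  · refine ciSup_le fun x => Real.le_sqrt_of_sq_le ?_
    by_cases hx : x ∈ orthant d n
    · exact Finset.single_le_sum (f := fun x => endpoint ω n x ^ 2) (fun _ _ => sq_nonneg _) hx
    · simpa [endpoint, mass_eq_zero ω hx] using replicaOverlap_nonneg ω n
  · by_contra! hle
    have h0 : ∀ x, endpoint ω n x = 0 := fun x =>
      le_antisymm ((endpoint_le_maxEndpoint hd hκ ω n x).trans hle) (endpoint_nonneg hd hκ ω n x)
    simpa [h0] using sum_endpoint hd hκ ω n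

/-! ### A strong law from second moments and bounded increments -/

lemma integrable_of_abs_le {α : Type*} [MeasurableSpace α] {P : Measure α} [IsFiniteMeasure P]
    {f : α → ℝ} (hf : Measurable f) {C : ℝ} (hC : ∀ x, |f x| ≤ C) : Integrable f P :=
  Integrable.of_bound hf.aestronglyMeasurable C (ae_of_all _ fun x => by simpa using hC x)

lemma abs_integral_le_of_abs_le {α : Type*} [MeasurableSpace α] {P : Measure α}
    [IsProbabilityMeasure P] {f : α → ℝ} {C : ℝ} (hC : ∀ x, |f x| ≤ C) :
    |∫ x, f x ∂P| ≤ C := by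
  simpa using norm_integral_le_of_norm_le_const (μ := P) (C := C) (f := f)
    (ae_of_all _ fun x => by simpa using hC x)

/-- A sequence with bounded increments whose second moments grow at most linearly satisfies the
strong law of large numbers. -/
lemma ae_tendsto_div_of_integral_sq_le {α : Type*} [MeasurableSpace α] {P : Measure α}
    {Y : ℕ → α → ℝ} (hY : ∀ n, Measurable (Y n)) (hint : ∀ n, Integrable (fun x => Y n x ^ 2) P)
    {C B : ℝ} (hC : ∀ n, ∫ x, Y n x ^ 2 ∂P ≤ C * n)
    (hB : ∀ n x, |Y (n + 1) x - Y n x| ≤ B) :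
    ∀ᵐ x ∂P, Tendsto (fun n : ℕ => Y n x / n) atTop (𝓝 0) := by
  -- Along the squares n = k² the second moment of Y_n / n is at most C / k², which is summable.
  have hsum : ∑' k : ℕ, ∫⁻ x, ENNReal.ofReal ((Y (k ^ 2) x / (k ^ 2 : ℕ)) ^ 2) ∂P ≠ ⊤ := by
    have hle : ∀ k : ℕ, ∫⁻ x, ENNReal.ofReal ((Y (k ^ 2) x / (k ^ 2 : ℕ)) ^ 2) ∂P ≤
        ENNReal.ofReal (C * (1 / (k : ℝ) ^ 2)) := by
      intro k
      rw [← ofReal_integral_eq_lintegral_ofReal]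
      · refine ENNReal.ofReal_le_ofReal ?_
        simp only [div_pow]
        rw [integral_div]
        rcases Nat.eq_zero_or_pos k with rfl | hk
        · simp
        · have hk' : (0 : ℝ) < k := by exact_mod_cast hk
          rw [div_le_iff₀ (by positivity)]
          refine (hC _).trans (le_of_eq ?_)
          push_cast
          field_simp
      · simp only [div_pow]
        exact (hint _).div_const _
      · exact ae_of_all _ fun x => sq_nonneg _
    have hs : Summable fun k : ℕ => C * (1 / (k : ℝ) ^ 2) :=
      (Real.summable_one_div_nat_pow.mpr one_lt_two).mul_left C
    exact ne_top_of_le_ne_top hs.tsum_ofReal_ne_top (ENNReal.tsum_le_tsum hle)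
  rw [← lintegral_tsum fun k =>
    (((hY _).div_const _).pow_const 2).ennreal_ofReal.aemeasurable] at hsum
  have hae := ae_lt_top' (AEMeasurable.tsum fun k =>
    (((hY (k ^ 2)).div_const ((k ^ 2 : ℕ) : ℝ)).pow_const 2).ennreal_ofReal.aemeasurable) hsum
  filter_upwards [hae] with x hx
  have h1 : Tendsto (fun k : ℕ => (Y (k ^ 2) x / (k ^ 2 : ℕ)) ^ 2) atTop (𝓝 0) := by
    have := (ENNReal.tendsto_toReal ENNReal.zero_ne_top).comp
      (ENNReal.tendsto_atTop_zero_of_tsum_ne_top hx.ne)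
    refine this.congr fun k => ?_
    simp [ENNReal.toReal_ofReal, sq_nonneg]
  have h2 : Tendsto (fun k : ℕ => |Y (k ^ 2) x / (k ^ 2 : ℕ)|) atTop (𝓝 0) := by
    have := h1.sqrt
    simpa [Real.sqrt_sq_eq_abs] using this
  have h3 : Tendsto (fun k : ℕ => |Y (k ^ 2) x / (k ^ 2 : ℕ)| + 2 * B / k) atTop (𝓝 0) := by
    simpa using h2.add (tendsto_const_div_atTop_nhds_zero_nat (2 * B))
  have hsqrt : Tendsto Nat.sqrt atTop atTop :=
    tendsto_atTop_mono' _ (Eventually.of_forall fun _ => le_rfl)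
      (tendsto_atTop_atTop.mpr fun b => ⟨b * b, fun a ha => Nat.le_sqrt.mpr ha⟩)
  have hinc : ∀ m j : ℕ, |Y (m + j) x - Y m x| ≤ j * B := by
    intro m j
    induction j with
    | zero => simp
    | succ j ih =>
      have := hB (m + j) x
      have := abs_sub_le (Y (m + (j + 1)) x) (Y (m + j) x) (Y m x)
      push_cast
      rw [← add_assoc] at *
      linarith
  have hB0 : 0 ≤ B := (abs_nonneg _).trans (hB 0 x)
  rw [tendsto_zero_iff_abs_tendsto_zero]
  refine squeeze_zero' (Eventually.of_forall fun n => abs_nonneg _) ?_ (h3.comp hsqrt)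
  filter_upwards [eventually_ge_atTop 1] with n hn
  set k := Nat.sqrt n with hk
  have hk1 : 1 ≤ k := Nat.le_sqrt.mpr (by simpa using hn)
  have hkn : k ^ 2 ≤ n := Nat.sqrt_le' n
  -- With k = ⌊√n⌋, at most 2k increments separate n from k²; they cost 2kB, hence 2B/k after
  -- division by k².
  obtain ⟨j, hj⟩ := Nat.exists_eq_add_of_le hkn
  have hj2 : j ≤ 2 * k := by
    have := Nat.sqrt_le_add n
    rw [← hk] at this
    nlinarith
  have hk0 : (0 : ℝ) < k := by exact_mod_cast hk1
  have hn0 : (0 : ℝ) < n := by exact_mod_cast hn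
  have hknR : ((k ^ 2 : ℕ) : ℝ) ≤ n := by exact_mod_cast hkn
  have h4 := hinc (k ^ 2) j
  rw [← hj] at h4
  have hjR : (j : ℝ) * B ≤ 2 * k * B := by
    have : (j : ℝ) ≤ 2 * k := by exact_mod_cast hj2
    exact mul_le_mul_of_nonneg_right this hB0
  have h5 : |Y n x| ≤ |Y (k ^ 2) x| + 2 * k * B := by
    have := abs_sub_abs_le_abs_sub (Y n x) (Y (k ^ 2) x)
    linarith
  simp only [Function.comp_apply, ← hk]
  rw [abs_div, abs_div, Nat.abs_cast, Nat.abs_cast]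
  have hk2 : (0 : ℝ) < (k ^ 2 : ℕ) := by positivity
  calc |Y n x| / n ≤ (|Y (k ^ 2) x| + 2 * k * B) / (k ^ 2 : ℕ) :=
        div_le_div₀ (by positivity) h5 (by positivity) hknR
    _ = _ := by
        push_cast
        field_simp

/-! ### The product law; conditional expectation by resampling the upper levels -/

/-- The law of a field of i.i.d. weights with marginal `ν`. -/
abbrev fieldLaw (ν : Measure (WeightVec d κ)) [IsProbabilityMeasure ν] : Measure (Field d κ) :=
  Measure.infinitePi (fun _ : Site d => ν)

/-- The field equal to `ω` below level `k` and to `ω'` from level `k` on. -/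
def glue (k : ℕ) (ω ω' : Field d κ) : Field d κ := fun x => if level x < k then ω x else ω' x

lemma glue_of_lt {k : ℕ} {x : Site d} (h : level x < k) (ω ω' : Field d κ) :
    glue k ω ω' x = ω x := if_pos h

lemma glue_of_le {k : ℕ} {x : Site d} (h : k ≤ level x) (ω ω' : Field d κ) :
    glue k ω ω' x = ω' x := if_neg h.not_gt

lemma measurable_glue (k : ℕ) :
    Measurable fun p : Field d κ × Field d κ => glue k p.1 p.2 := by
  refine measurable_pi_iff.mpr fun x => ?_
  by_cases h : level x < k
  · simp only [glue_of_lt h]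
    fun_prop
  · simp only [glue_of_le (not_lt.mp h)]
    fun_prop

@[fun_prop]
lemma measurable_glue_right (k : ℕ) (ω : Field d κ) : Measurable (glue k ω) :=
  (measurable_glue k).comp measurable_prodMk_left

variable (ν : Measure (WeightVec d κ)) [IsProbabilityMeasure ν]

/-- The two halves use disjoint sets of sites, so a field patched from two independent copies has
the same law. Integrating over the second copy is therefore conditioning on the levels below `k`,
with no σ-algebra needed. -/
lemma map_glue (k : ℕ) :
    ((fieldLaw ν).prod (fieldLaw ν)).map (fun p => glue k p.1 p.2) = fieldLaw ν := by
  refine Measure.eq_infinitePi _ fun s t ht => ?_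
  rw [Measure.map_apply (measurable_glue k)
    (MeasurableSet.pi s.countable_toSet fun i _ => ht i)]
  have : (fun p : Field d κ × Field d κ => glue k p.1 p.2) ⁻¹' (Set.pi s t) =
      (Set.pi (s.filter fun x => level x < k) t) ×ˢ
        (Set.pi (s.filter fun x => ¬ level x < k) t) := by
    ext p
    simp only [Set.mem_preimage, Set.mem_pi, Set.mem_prod, Finset.mem_coe, Finset.mem_filter]
    constructor
    · intro h
      refine ⟨fun x hx => ?_, fun x hx => ?_⟩
      · rw [← glue_of_lt hx.2 p.1 p.2]
        exact h x hx.1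
      · rw [← glue_of_le (not_lt.mp hx.2) p.1 p.2]
        exact h x hx.1
    · intro h x hx
      by_cases hl : level x < k
      · rw [glue_of_lt hl]
        exact h.1 x ⟨hx, hl⟩
      · rw [glue_of_le (not_lt.mp hl)]
        exact h.2 x ⟨hx, hl⟩
  rw [this, Measure.prod_prod, Measure.infinitePi_pi _ fun i _ => ht i,
    Measure.infinitePi_pi _ fun i _ => ht i, Finset.prod_filter_mul_prod_filter_not]

lemma integral_glue_of_integrable (k : ℕ) {F : Field d κ → ℝ} (hF : Measurable F)
    (hi : Integrable F (fieldLaw ν)) :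
    ∫ ω, ∫ ω', F (glue k ω ω') ∂(fieldLaw ν) ∂(fieldLaw ν) = ∫ ω, F ω ∂(fieldLaw ν) := by
  have hi' := hi
  rw [← map_glue ν k, integrable_map_measure hF.aestronglyMeasurable
    (measurable_glue k).aemeasurable] at hi'
  conv_rhs => rw [← map_glue ν k]
  rw [integral_map (measurable_glue k).aemeasurable hF.aestronglyMeasurable,
    integral_prod (fun p : Field d κ × Field d κ => F (glue k p.1 p.2)) hi']

lemma integral_glue (k : ℕ) {F : Field d κ → ℝ} (hF : Measurable F) {C : ℝ}
    (hC : ∀ ω, |F ω| ≤ C) :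
    ∫ ω, ∫ ω', F (glue k ω ω') ∂(fieldLaw ν) ∂(fieldLaw ν) = ∫ ω, F ω ∂(fieldLaw ν) :=
  integral_glue_of_integrable ν k hF (integrable_of_abs_le hF hC)

@[fun_prop]
lemma measurable_shift (x : Site d) : Measurable (shift x : Field d κ → Field d κ) :=
  measurable_pi_iff.mpr fun _ => measurable_pi_apply _

lemma map_shift (x : Site d) : (fieldLaw ν).map (shift x) = fieldLaw ν := by
  classical
  refine Measure.eq_infinitePi _ fun s t ht => ?_
  rw [Measure.map_apply (measurable_shift x)
    (MeasurableSet.pi s.countable_toSet fun i _ => ht i)]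
  have : (shift x : Field d κ → Field d κ) ⁻¹' (Set.pi s t) =
      Set.pi (s.image (x + ·) : Finset (Site d)) (fun y => t (y - x)) := by
    ext ω
    simp only [shift, Set.mem_preimage, Set.mem_pi, Finset.mem_coe, Finset.mem_image]
    constructor
    · rintro h _ ⟨y, hy, rfl⟩
      simpa using h y hy
    · intro h y hy
      simpa using h (x + y) ⟨y, hy, rfl⟩
  rw [this, Measure.infinitePi_pi _ fun i _ => ht _,
    Finset.prod_image fun a _ b _ h => add_left_cancel h]
  simp

lemma integral_shift (x : Site d) {F : Field d κ → ℝ} (hF : Measurable F) :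
    ∫ ω, F (shift x ω) ∂(fieldLaw ν) = ∫ ω, F ω ∂(fieldLaw ν) := by
  conv_rhs => rw [← map_shift ν x]
  rw [integral_map (measurable_shift x).aemeasurable hF.aestronglyMeasurable]

lemma integral_eval (x : Site d) {f : WeightVec d κ → ℝ} (hf : Measurable f) :
    ∫ ω, f (ω x) ∂(fieldLaw ν) = ∫ s, f s ∂ν := by
  conv_rhs => rw [← Measure.infinitePi_map_eval (fun _ : Site d => ν) x]
  rw [integral_map (measurable_pi_apply x).aemeasurable hf.aestronglyMeasurable]

/-- Pythagoras for bounded differences that are centred given the lower levels. -/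
lemma integral_sq_sum_le {D : ℕ → Field d κ → ℝ} (hm : ∀ k, Measurable (D k)) {K : ℝ}
    (hK : ∀ k ω, |D k ω| ≤ K)
    (hdep : ∀ (k : ℕ) ω ω', (∀ x, level x < (k : ℤ) + 1 → ω x = ω' x) → D k ω = D k ω')
    (hzero : ∀ k ω, ∫ ω', D k (glue k ω ω') ∂(fieldLaw ν) = 0) (n : ℕ) :
    ∫ ω, (∑ k ∈ Finset.range n, D k ω) ^ 2 ∂(fieldLaw ν) ≤ K ^ 2 * n := by
  have hSm : ∀ n, Measurable fun ω => ∑ k ∈ Finset.range n, D k ω := fun n =>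
    Finset.measurable_sum _ fun k _ => hm k
  have hSb : ∀ n ω, |∑ k ∈ Finset.range n, D k ω| ≤ n * K := fun n ω => by
    refine (Finset.abs_sum_le_sum_abs _ _).trans ?_
    refine (Finset.sum_le_sum fun k _ => hK k ω).trans ?_
    simp
  induction n with
  | zero => simp
  | succ n ih =>
    -- Resampling from level `n` upwards leaves the earlier differences fixed, and the last one
    -- integrates to zero.
    have hcross : ∫ ω, (∑ k ∈ Finset.range n, D k ω) * D n ω ∂(fieldLaw ν) = 0 := by
      rw [← integral_glue ν n (F := fun ω => (∑ k ∈ Finset.range n, D k ω) * D n ω)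
          ((hSm n).mul (hm n)) (C := n * K * K) fun ω => by
        rw [abs_mul]
        exact mul_le_mul (hSb n ω) (hK n ω) (abs_nonneg _) ((abs_nonneg _).trans (hSb n ω))]
      have : ∀ ω ω', (∑ k ∈ Finset.range n, D k (glue n ω ω')) * D n (glue n ω ω') =
          (∑ k ∈ Finset.range n, D k ω) * D n (glue n ω ω') := by
        intro ω ω'
        congr 1
        refine Finset.sum_congr rfl fun k hk => hdep k _ _ fun x hx => glue_of_lt ?_ _ _
        have := Finset.mem_range.mp hk
        omega
      simp only [this, integral_const_mul, hzero, mul_zero, integral_zero]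
    have hi1 : Integrable (fun ω => (∑ k ∈ Finset.range n, D k ω) ^ 2) (fieldLaw ν) :=
      integrable_of_abs_le ((hSm n).pow_const 2) (C := (n * K) ^ 2) fun ω => by
        rw [abs_pow]
        exact pow_le_pow_left₀ (abs_nonneg _) (hSb n ω) 2
    have hi2 : Integrable (fun ω => (∑ k ∈ Finset.range n, D k ω) * D n ω) (fieldLaw ν) :=
      integrable_of_abs_le ((hSm n).mul (hm n)) (C := n * K * K) fun ω => by
        rw [abs_mul]
        exact mul_le_mul (hSb n ω) (hK n ω) (abs_nonneg _) ((abs_nonneg _).trans (hSb n ω))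
    have hsq : ∀ ω, |D n ω ^ 2| ≤ K ^ 2 := fun ω => by
      rw [abs_pow]
      exact pow_le_pow_left₀ (abs_nonneg _) (hK n ω) 2
    have hi3 : Integrable (fun ω => D n ω ^ 2) (fieldLaw ν) :=
      integrable_of_abs_le ((hm n).pow_const 2) hsq
    have h3 : ∫ ω, D n ω ^ 2 ∂(fieldLaw ν) ≤ K ^ 2 :=
      (le_abs_self _).trans (abs_integral_le_of_abs_le hsq)
    have hexp : ∀ ω, (∑ k ∈ Finset.range (n + 1), D k ω) ^ 2 =
        (∑ k ∈ Finset.range n, D k ω) ^ 2 + 2 * ((∑ k ∈ Finset.range n, D k ω) * D n ω) +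
          D n ω ^ 2 := fun ω => by
      rw [Finset.sum_range_succ]
      ring
    simp only [hexp]
    rw [integral_add (by exact hi1.add (hi2.const_mul 2)) hi3,
      integral_add hi1 (hi2.const_mul 2),
      integral_const_mul, hcross]
    push_cast
    linarith

/-! ### Measurability -/

@[fun_prop]
lemma measurable_weight (x : Site d) (i : Fin d) :
    Measurable fun ω : Field d κ => (ω x).1 i :=
  (measurable_pi_apply i).comp (measurable_subtype_coe.comp (measurable_pi_apply x))

@[fun_prop]
lemma measurable_rowSum : Measurable (rowSum : WeightVec d κ → ℝ) :=
  Finset.measurable_sum _ fun i _ => (measurable_pi_apply i).comp measurable_subtype_coe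

lemma measurable_rowSum_eval (x : Site d) : Measurable fun ω : Field d κ => rowSum (ω x) :=
  Finset.measurable_sum _ fun i _ => measurable_weight x i

@[fun_prop]
lemma measurable_mass (n : ℕ) (x : Site d) : Measurable fun ω : Field d κ => mass ω n x := by
  induction n generalizing x with
  | zero => exact measurable_const
  | succ n ih =>
    exact Finset.measurable_sum _ fun i _ => (ih _).mul (measurable_weight _ _)

@[fun_prop]
lemma measurable_partition (n : ℕ) : Measurable fun ω : Field d κ => partition ω n :=
  Finset.measurable_sum _ fun x _ => measurable_mass n x

@[fun_prop]
lemma measurable_endpoint (n : ℕ) (x : Site d) : Measurable fun ω : Field d κ => endpoint ω n x :=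
  (measurable_mass n x).div (measurable_partition n)

@[fun_prop]
lemma measurable_replicaOverlap (n : ℕ) : Measurable fun ω : Field d κ => replicaOverlap ω n :=
  Finset.measurable_sum _ fun x _ => (measurable_endpoint n x).pow_const 2

lemma measurable_growth (n : ℕ) :
    Measurable fun p : Field d κ × Field d κ => growth p.1 p.2 n :=
  Finset.measurable_sum _ fun x _ => ((measurable_endpoint n x).comp measurable_fst).mul
    (measurable_rowSum.comp ((measurable_pi_apply x).comp measurable_snd))

@[fun_prop]
lemma measurable_growth_self (n : ℕ) : Measurable fun ω : Field d κ => growth ω ω n :=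
  (measurable_growth n).comp (measurable_id.prodMk measurable_id)

@[fun_prop]
lemma measurable_growth_right (n : ℕ) (ω : Field d κ) : Measurable fun ω' => growth ω ω' n :=
  (measurable_growth n).comp measurable_prodMk_left

/-! ### The quenched free energy: superadditivity and concentration -/

lemma integrable_log_partition (hd : 0 < d) (hκ : 0 < κ) (n : ℕ) :
    Integrable (fun ω => Real.log (partition ω n)) (fieldLaw ν) :=
  integrable_of_abs_le (measurable_partition n).log fun ω => abs_log_partition_le hd hκ ω n

/-- Jensen for the logarithm under the endpoint law at level `n`, after cutting paths there. -/
lemma sum_endpoint_mul_log_le (hd : 0 < d) (hκ : 0 < κ) (ω : Field d κ) (n m : ℕ) :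
    Real.log (partition ω n) +
        ∑ x ∈ orthant d n, endpoint ω n x * Real.log (partition (shift x ω) m) ≤
      Real.log (partition ω (n + m)) := by
  have hsplit : partition ω (n + m) =
      partition ω n * ∑ x ∈ orthant d n, endpoint ω n x * partition (shift x ω) m := by
    rw [partition_add, Finset.mul_sum]
    refine Finset.sum_congr rfl fun x _ => ?_
    have := (partition_pos hd hκ ω n).ne'
    rw [endpoint]
    field_simp
  have hpos : 0 < ∑ x ∈ orthant d n, endpoint ω n x * partition (shift x ω) m := by
    have := partition_pos hd hκ ω (n + m)
    rw [hsplit] at this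
    exact pos_of_mul_pos_right this (partition_pos hd hκ ω n).le
  rw [hsplit, Real.log_mul (partition_pos hd hκ _ _).ne' hpos.ne']
  have := strictConcaveOn_log_Ioi.concaveOn.le_map_sum (t := orthant d n)
    (w := endpoint ω n) (p := fun x => partition (shift x ω) m)
    (fun x _ => endpoint_nonneg hd hκ ω n x) (sum_endpoint hd hκ ω n)
    (fun x _ => partition_pos hd hκ _ _)
  simp only [smul_eq_mul] at this
  linarith

/-- The endpoint law reads levels below `n`, the shifted partition function levels from `n` on. They
are independent, and stationarity removes the shift. -/
lemma integral_endpoint_mul_log_partition_shift (hd : 0 < d) (hκ : 0 < κ) {n : ℕ} (m : ℕ)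
    {x : Site d} (hx : x ∈ orthant d n) :
    ∫ ω, endpoint ω n x * Real.log (partition (shift x ω) m) ∂(fieldLaw ν) =
      (∫ ω, endpoint ω n x ∂(fieldLaw ν)) * ∫ ω, Real.log (partition ω m) ∂(fieldLaw ν) := by
  rw [← integral_glue ν n
    (F := fun ω => endpoint ω n x * Real.log (partition (shift x ω) m))
    ((measurable_endpoint n x).mul (((measurable_partition m).comp (measurable_shift x)).log))
    (C := 1 * (m * logBound d κ)) fun ω => by
      rw [abs_mul, abs_of_nonneg (endpoint_nonneg hd hκ ω n x)]
      exact mul_le_mul (endpoint_le_one hd hκ ω n x) (abs_log_partition_le hd hκ _ m)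
        (abs_nonneg _) zero_le_one]
  have h1 : ∀ ω ω' : Field d κ, endpoint (glue n ω ω') n x = endpoint ω n x := fun ω ω' =>
    endpoint_congr (fun y _ hy => glue_of_lt hy _ _) x
  have h2 : ∀ ω ω' : Field d κ,
      partition (shift x (glue n ω ω')) m = partition (shift x ω') m := fun ω ω' =>
    partition_congr fun y hy _ => glue_of_le (by
      rw [level_add, (mem_orthant.mp hx).2]
      linarith) _ _
  simp only [h1, h2, integral_const_mul, integral_mul_const]
  rw [integral_shift ν x (F := fun ω => Real.log (partition ω m)) (measurable_partition m).log]

lemma integral_log_partition_add_le (hd : 0 < d) (hκ : 0 < κ) (n m : ℕ) :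
    ∫ ω, Real.log (partition ω n) ∂(fieldLaw ν) + ∫ ω, Real.log (partition ω m) ∂(fieldLaw ν) ≤
      ∫ ω, Real.log (partition ω (n + m)) ∂(fieldLaw ν) := by
  have hint : ∀ x, Integrable
      (fun ω => endpoint ω n x * Real.log (partition (shift x ω) m)) (fieldLaw ν) := fun x =>
    integrable_of_abs_le
      ((measurable_endpoint n x).mul (((measurable_partition m).comp (measurable_shift x)).log))
      (C := 1 * (m * logBound d κ)) fun ω => by
        rw [abs_mul, abs_of_nonneg (endpoint_nonneg hd hκ ω n x)]
        exact mul_le_mul (endpoint_le_one hd hκ ω n x) (abs_log_partition_le hd hκ _ m)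
          (abs_nonneg _) zero_le_one
  have hsum := integrable_finsetSum (orthant d n) fun x _ => hint x
  have h := integral_mono ((integrable_log_partition ν hd hκ n).add hsum)
    (integrable_log_partition ν hd hκ (n + m)) fun ω => sum_endpoint_mul_log_le hd hκ ω n m
  refine le_trans (le_of_eq ?_) h
  simp only [Pi.add_apply]
  rw [integral_add (integrable_log_partition ν hd hκ n) hsum,
    integral_finsetSum _ fun x _ => hint x,
    Finset.sum_congr rfl fun x hx => integral_endpoint_mul_log_partition_shift ν hd hκ m hx,
    ← Finset.sum_mul, ← integral_finsetSum _ fun x _ =>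
      integrable_of_abs_le (measurable_endpoint n x) (C := 1) fun ω => by
        rw [abs_of_nonneg (endpoint_nonneg hd hκ ω n x)]
        exact endpoint_le_one hd hκ ω n x]
  simp only [sum_endpoint hd hκ]
  simp

/-- The averaged logarithm of the partition function grows linearly. -/
lemma exists_tendsto_integral_log_partition (hd : 0 < d) (hκ : 0 < κ) :
    ∃ p : ℝ, Tendsto (fun n : ℕ => (∫ ω, Real.log (partition ω n) ∂(fieldLaw ν)) / n) atTop
      (𝓝 p) := by
  have hsub : Subadditive fun n => -∫ ω, Real.log (partition ω n) ∂(fieldLaw ν) := fun n m => by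
    have := integral_log_partition_add_le ν hd hκ n m
    linarith
  have hbdd : BddBelow (Set.range fun n : ℕ =>
      (-∫ ω, Real.log (partition ω n) ∂(fieldLaw ν)) / n) := by
    refine ⟨-logBound d κ, ?_⟩
    rintro _ ⟨n, rfl⟩
    dsimp only
    rcases Nat.eq_zero_or_pos n with rfl | hn
    · simpa using logBound_nonneg
    · have hn' : (0 : ℝ) < n := by exact_mod_cast hn
      rw [le_div_iff₀ hn']
      have := le_of_abs_le (abs_integral_le_of_abs_le (P := fieldLaw ν)
        fun ω => abs_log_partition_le hd hκ ω n)
      linarith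
  refine ⟨-hsub.lim, ?_⟩
  refine (hsub.tendsto_lim hbdd).neg.congr fun n => ?_
  rw [neg_div, neg_neg]

/-- The conditional mean of `F` given the field below level `k`. -/
def belowMean (k : ℕ) (F : Field d κ → ℝ) (ω : Field d κ) : ℝ :=
  ∫ ω', F (glue k ω ω') ∂(fieldLaw ν)

lemma measurable_belowMean (k : ℕ) {F : Field d κ → ℝ} (hF : Measurable F) :
    Measurable (belowMean ν k F) := by
  have : StronglyMeasurable fun p : Field d κ × Field d κ => F (glue k p.1 p.2) :=
    (hF.comp (measurable_glue k)).stronglyMeasurable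
  exact this.integral_prod_right.measurable

lemma belowMean_congr (k : ℕ) (F : Field d κ → ℝ) {ω ω' : Field d κ}
    (h : ∀ x, level x < k → ω x = ω' x) : belowMean ν k F ω = belowMean ν k F ω' := by
  have : ∀ ω'', glue k ω ω'' = glue k ω' ω'' := fun ω'' => funext fun x => by
    by_cases hx : level x < k
    · rw [glue_of_lt hx, glue_of_lt hx, h x hx]
    · rw [glue_of_le (not_lt.mp hx), glue_of_le (not_lt.mp hx)]
  simp only [belowMean, this]

lemma belowMean_glue (k : ℕ) {F : Field d κ → ℝ} (ω ω' : Field d κ) :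
    belowMean ν k F (glue k ω ω') = belowMean ν k F ω :=
  belowMean_congr ν k F fun _ hx => glue_of_lt hx _ _

/-- The tower property; it says that the increments of `belowMean` in `k` are martingale
differences. -/
lemma integral_belowMean_succ_glue (k : ℕ) {F : Field d κ → ℝ} (hF : Measurable F) {C : ℝ}
    (hC : ∀ ω, |F ω| ≤ C) (ω : Field d κ) :
    ∫ ω', belowMean ν (k + 1) F (glue k ω ω') ∂(fieldLaw ν) = belowMean ν k F ω := by
  -- Both sides take `ω` below `k`, `ω'` on level `k` and `ω''` above, so the two resamplings merge
  -- into one.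
  have hglue : ∀ ω' ω'' : Field d κ,
      glue (k + 1) (glue k ω ω') ω'' = glue k ω (glue (k + 1) ω' ω'') := fun ω' ω'' =>
    funext fun x => by
      simp only [glue]
      split_ifs with h1 h2 <;> first | rfl | (push_cast at *; omega)
  simp only [belowMean, hglue]
  exact integral_glue ν (k + 1) (F := fun ω' => F (glue k ω ω'))
    (hF.comp (measurable_glue_right k ω)) fun _ => hC _

/-- Gluing at 0 keeps only negative levels of `ω`, which `F` does not read: conditioning is trivial.
-/
lemma belowMean_zero (F : Field d κ → ℝ) (ω : Field d κ) (hF : ∀ ω ω' : Field d κ,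
      (∀ x, 0 ≤ level x → ω x = ω' x) → F ω = F ω') :
    belowMean ν 0 F ω = ∫ ω, F ω ∂(fieldLaw ν) := by
  refine integral_congr_ae (ae_of_all _ fun ω' => hF _ _ fun x hx => ?_)
  exact glue_of_le (by simpa using hx) _ _

/-- Revealing the levels one by one gives `n` orthogonal martingale differences, each the effect of
changing a single level and so bounded by log max(1, κ⁻¹). -/
lemma variance_log_partition_le (hd : 0 < d) (hκ : 0 < κ) (n : ℕ) :
    ∫ ω, (Real.log (partition ω n) - ∫ ω', Real.log (partition ω' n) ∂(fieldLaw ν)) ^ 2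
      ∂(fieldLaw ν) ≤ Real.log (max 1 κ⁻¹) ^ 2 * n := by
  obtain ⟨F, hF⟩ : ∃ F : Field d κ → ℝ, F = fun ω => Real.log (partition ω n) := ⟨_, rfl⟩
  have hFm : Measurable F := hF ▸ (measurable_partition n).log
  have hFb : ∀ ω, |F ω| ≤ n * logBound d κ := fun ω =>
    hF ▸ abs_log_partition_le hd hκ ω n
  have hFint : ∀ k ω, Integrable (fun ω' => F (glue k ω ω')) (fieldLaw ν) := fun k ω =>
    integrable_of_abs_le (hFm.comp (measurable_glue_right k ω)) fun _ => hFb _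
  have htel : ∀ ω, F ω - ∫ ω', F ω' ∂(fieldLaw ν) =
      ∑ k ∈ Finset.range n, (belowMean ν (k + 1) F ω - belowMean ν k F ω) := by
    intro ω
    rw [Finset.sum_range_sub fun k => belowMean ν k F ω, belowMean_zero]
    · have : ∀ ω', F (glue n ω ω') = F ω := fun ω' => by
        simp only [hF]
        rw [partition_congr fun x _ hx => glue_of_lt hx _ _]
      simp [belowMean, this]
    · intro ω ω' h
      simp only [hF]
      rw [partition_congr fun x hx _ => h x hx]
  have hrw : ∀ ω, Real.log (partition ω n) - ∫ ω', Real.log (partition ω' n) ∂(fieldLaw ν) =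
      ∑ k ∈ Finset.range n, (belowMean ν (k + 1) F ω - belowMean ν k F ω) := fun ω => by
    rw [← htel, hF]
  simp only [hrw]
  refine integral_sq_sum_le ν (D := fun k ω => belowMean ν (k + 1) F ω - belowMean ν k F ω)
    (fun k => (measurable_belowMean ν _ hFm).sub (measurable_belowMean ν _ hFm)) ?_ ?_ ?_ n
  · intro k ω
    simp only [belowMean]
    rw [← integral_sub (hFint _ _) (hFint _ _)]
    refine abs_integral_le_of_abs_le fun ω' => ?_
    rw [hF]
    refine abs_log_partition_sub_le hd hκ (k := k) ?_ n
    intro x hx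
    simp only [glue]
    split_ifs with h1 h2 <;> first | rfl | (push_cast at *; omega)
  · intro k ω ω' h
    rw [belowMean_congr ν (k + 1) F fun x hx => h x (by exact_mod_cast hx),
      belowMean_congr ν k F fun x hx => h x (by omega)]
  · intro k ω
    have hb : ∀ j ω, |belowMean ν j F ω| ≤ n * logBound d κ := fun j ω =>
      abs_integral_le_of_abs_le fun _ => hFb _
    rw [integral_sub, integral_belowMean_succ_glue ν k hFm hFb]
    · simp [belowMean_glue]
    · exact integrable_of_abs_le
        ((measurable_belowMean ν _ hFm).comp (measurable_glue_right k ω)) fun _ => hb _ _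
    · exact integrable_of_abs_le
        ((measurable_belowMean ν _ hFm).comp (measurable_glue_right k ω)) fun _ => hb _ _

/-- Existence of the quenched free energy of the directed polymer. -/
theorem exists_freeEnergy (hd : 0 < d) (hκ : 0 < κ) :
    ∃ p : ℝ, ∀ᵐ ω ∂(fieldLaw ν),
      Tendsto (fun n : ℕ => Real.log (partition ω n) / n) atTop (𝓝 p) := by
  obtain ⟨p, hp⟩ := exists_tendsto_integral_log_partition ν hd hκ
  refine ⟨p, ?_⟩
  have hb : ∀ n, |∫ ω, Real.log (partition ω n) ∂(fieldLaw ν)| ≤ n * logBound d κ := fun n =>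
    abs_integral_le_of_abs_le fun ω => abs_log_partition_le hd hκ ω n
  have hconc := ae_tendsto_div_of_integral_sq_le (P := fieldLaw ν)
    (Y := fun n ω => Real.log (partition ω n) - ∫ ω', Real.log (partition ω' n) ∂(fieldLaw ν))
    (fun n => (measurable_partition n).log.sub_const _)
    (fun n => integrable_of_abs_le (((measurable_partition n).log.sub_const _).pow_const 2)
      (C := (n * logBound d κ + n * logBound d κ) ^ 2) fun ω => by
        rw [abs_pow]
        refine pow_le_pow_left₀ (abs_nonneg _) ((abs_sub _ _).trans ?_) 2
        exact add_le_add (abs_log_partition_le hd hκ ω n) (hb n))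
    (fun n => variance_log_partition_le ν hd hκ n)
    (B := logBound d κ + logBound d κ) (fun n ω => by
      have h1 : ∫ ω', Real.log (partition ω' (n + 1)) ∂(fieldLaw ν) =
          ∫ ω', Real.log (partition ω' n) ∂(fieldLaw ν) +
            ∫ ω', Real.log (growth ω' ω' n) ∂(fieldLaw ν) := by
        rw [← integral_add (integrable_log_partition ν hd hκ n)
          (integrable_of_abs_le (measurable_growth_self n).log
            fun ω => abs_log_growth_le hd hκ ω ω n)]
        simp only [log_partition_succ hd hκ]
      have h2 := abs_log_growth_le hd hκ ω ω n
      have h3 : |∫ ω', Real.log (growth ω' ω' n) ∂(fieldLaw ν)| ≤ logBound d κ :=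
        abs_integral_le_of_abs_le fun ω => abs_log_growth_le hd hκ ω ω n
      rw [h1, log_partition_succ hd hκ]
      rw [abs_le] at *
      constructor <;> linarith)
  filter_upwards [hconc] with ω hω
  have := hω.add hp
  rw [zero_add] at this
  refine this.congr fun n => ?_
  rw [← add_div, sub_add_cancel]

/-! ### Drift decomposition of the logarithm of the partition function -/

/-- The conditional mean of the logarithmic growth of the partition function. -/
def drift (n : ℕ) (ω : Field d κ) : ℝ := ∫ ω', Real.log (growth ω ω' n) ∂(fieldLaw ν)

lemma measurable_drift (n : ℕ) : Measurable (drift ν n) := by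
  have : StronglyMeasurable fun p : Field d κ × Field d κ => Real.log (growth p.1 p.2 n) :=
    (measurable_growth n).log.stronglyMeasurable
  exact this.integral_prod_right.measurable

lemma abs_drift_le (hd : 0 < d) (hκ : 0 < κ) (n : ℕ) (ω : Field d κ) :
    |drift ν n ω| ≤ logBound d κ :=
  abs_integral_le_of_abs_le fun ω' => abs_log_growth_le hd hκ ω ω' n

lemma drift_congr {n : ℕ} {ω ω' : Field d κ} (h : ∀ x, level x < n → ω x = ω' x) :
    drift ν n ω = drift ν n ω' := by
  refine integral_congr_ae (ae_of_all _ fun ω'' => ?_)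
  dsimp only
  rw [growth_congr (fun x _ hx => h x hx) fun _ _ => rfl]

/-- The logarithm of the partition function is asymptotically the sum of its drifts. -/
theorem ae_tendsto_log_partition_sub_sum_drift (hd : 0 < d) (hκ : 0 < κ) :
    ∀ᵐ ω ∂(fieldLaw ν), Tendsto (fun n : ℕ => (Real.log (partition ω n) -
      ∑ k ∈ Finset.range n, drift ν k ω) / n) atTop (𝓝 0) := by
  have hDm : ∀ k, Measurable fun ω => Real.log (growth ω ω k) - drift ν k ω := fun k =>
    (measurable_growth_self k).log.sub (measurable_drift ν k)
  have hDb : ∀ k ω, |Real.log (growth ω ω k) - drift ν k ω| ≤ logBound d κ + logBound d κ :=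
    fun k ω => (abs_sub _ _).trans
      (add_le_add (abs_log_growth_le hd hκ ω ω k) (abs_drift_le ν hd hκ k ω))
  have hrw : ∀ (n : ℕ) ω, Real.log (partition ω n) - ∑ k ∈ Finset.range n, drift ν k ω =
      ∑ k ∈ Finset.range n, (Real.log (growth ω ω k) - drift ν k ω) := fun n ω => by
    rw [log_partition_eq_sum hd hκ, Finset.sum_sub_distrib]
  simp only [hrw]
  have hSm : ∀ n, Measurable fun ω =>
      ∑ k ∈ Finset.range n, (Real.log (growth ω ω k) - drift ν k ω) := fun n =>
    Finset.measurable_sum _ fun k _ => hDm k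
  refine ae_tendsto_div_of_integral_sq_le hSm (B := logBound d κ + logBound d κ)
    (C := (logBound d κ + logBound d κ) ^ 2) ?_ ?_ ?_
  · intro n
    refine integrable_of_abs_le ((hSm n).pow_const 2)
      (C := (n * (logBound d κ + logBound d κ)) ^ 2) fun ω => ?_
    rw [abs_pow]
    refine pow_le_pow_left₀ (abs_nonneg _) ((Finset.abs_sum_le_sum_abs _ _).trans ?_) 2
    refine (Finset.sum_le_sum fun k _ => hDb k ω).trans (le_of_eq ?_)
    rw [Finset.sum_const, Finset.card_range, nsmul_eq_mul]
  · refine integral_sq_sum_le ν hDm hDb ?_ ?_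
    · intro k ω ω' h
      rw [growth_congr (fun x _ hx => h x (by omega)) fun x hx => h x (by omega),
        drift_congr ν fun x hx => h x (by omega)]
    · intro k ω
      -- Resampling from level `k` keeps the endpoint law and renews exactly the weights being
      -- averaged, so the mean of the log growth becomes the drift.
      have h1 : ∀ ω', growth (glue k ω ω') (glue k ω ω') k = growth ω ω' k := fun ω' =>
        growth_congr (fun x _ hx => glue_of_lt hx _ _) fun x hx => glue_of_le hx.ge _ _
      have h2 : ∀ ω', drift ν k (glue k ω ω') = drift ν k ω := fun ω' =>
        drift_congr ν fun x hx => glue_of_lt hx _ _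
      simp only [h1, h2]
      rw [integral_sub (integrable_of_abs_le (measurable_growth_right k ω).log
        fun ω' => abs_log_growth_le hd hκ ω ω' k) (integrable_const _)]
      simp [drift]
  · intro n ω
    rw [Finset.sum_range_succ, add_sub_cancel_left]
    exact hDb n ω

/-! ### The drift gap is comparable to variance times overlap -/

/-- The mean of the total outgoing weight. -/
def meanWeight (ν : Measure (WeightVec d κ)) : ℝ := ∫ s, rowSum s ∂ν

/-- The variance of the total outgoing weight. -/
def varWeight (ν : Measure (WeightVec d κ)) : ℝ := Var[rowSum; ν]

lemma abs_rowSum_le (hd : 0 < d) (hκ : 0 < κ) (s : WeightVec d κ) : |rowSum s| ≤ d := by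
  rw [abs_of_nonneg (hκ.le.trans (le_rowSum hd hκ s))]
  exact rowSum_le s

lemma integrable_rowSum (hd : 0 < d) (hκ : 0 < κ) : Integrable rowSum ν :=
  integrable_of_abs_le measurable_rowSum (abs_rowSum_le hd hκ)

lemma le_meanWeight (hd : 0 < d) (hκ : 0 < κ) : κ ≤ meanWeight ν := by
  have := integral_mono (integrable_const κ) (integrable_rowSum ν hd hκ) (le_rowSum hd hκ)
  rw [integral_const, probReal_univ, one_smul] at this
  exact this

lemma meanWeight_le (hd : 0 < d) (hκ : 0 < κ) : meanWeight ν ≤ d := by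
  have := integral_mono (integrable_rowSum ν hd hκ) (integrable_const (d : ℝ)) rowSum_le
  rw [integral_const, probReal_univ, one_smul] at this
  exact this

lemma integral_growth (hd : 0 < d) (hκ : 0 < κ) (ω : Field d κ) (n : ℕ) :
    ∫ ω', growth ω ω' n ∂(fieldLaw ν) = meanWeight ν := by
  have hint : ∀ x, Integrable (fun ω' : Field d κ => endpoint ω n x * rowSum (ω' x))
      (fieldLaw ν) := fun x =>
    (integrable_of_abs_le (measurable_rowSum_eval x)
      fun ω' => abs_rowSum_le hd hκ (ω' x)).const_mul _
  simp only [growth]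
  rw [integral_finsetSum _ fun x _ => hint x]
  simp only [integral_const_mul, integral_eval ν _ measurable_rowSum]
  rw [← Finset.sum_mul, sum_endpoint hd hκ, one_mul, meanWeight]

/-- For a frozen endpoint law the growth is a weighted sum of i.i.d. total weights, and the squared
coefficients add up to the overlap. -/
lemma integral_growth_sub_sq (hd : 0 < d) (hκ : 0 < κ) (ω : Field d κ) (n : ℕ) :
    ∫ ω', (growth ω ω' n - meanWeight ν) ^ 2 ∂(fieldLaw ν) =
      varWeight ν * replicaOverlap ω n := by
  have hmem : ∀ x, MemLp (fun ω' : Field d κ => rowSum (ω' x)) 2 (fieldLaw ν) := fun x =>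
    MemLp.of_bound (measurable_rowSum_eval x).aestronglyMeasurable d
      (ae_of_all _ fun ω' => abs_rowSum_le hd hκ (ω' x))
  have hvar : ∀ x, Var[fun ω' : Field d κ => rowSum (ω' x); fieldLaw ν] = varWeight ν := by
    intro x
    rw [variance_eq_integral (measurable_rowSum_eval x).aemeasurable,
      integral_eval ν x measurable_rowSum, integral_eval ν x
        (f := fun s => (rowSum s - ∫ s, rowSum s ∂ν) ^ 2) ((measurable_rowSum.sub_const _).pow_const 2),
      varWeight, variance_eq_integral measurable_rowSum.aemeasurable]
  have hind : iIndepFun (fun x (ω' : Field d κ) => rowSum (ω' x)) (fieldLaw ν) := by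
    have := iIndepFun_infinitePi (P := fun _ : Site d => ν) (X := fun _ s => rowSum s)
      (fun _ => measurable_rowSum)
    exact this
  have hsum := IndepFun.variance_sum (μ := fieldLaw ν)
    (X := fun x (ω' : Field d κ) => endpoint ω n x * rowSum (ω' x)) (s := orthant d n)
    (fun x _ => (hmem x).const_mul _)
    (fun x _ y _ hxy => (hind.indepFun hxy).comp (measurable_const_mul (endpoint ω n x))
      (measurable_const_mul (endpoint ω n y)))
  have hg : (∑ x ∈ orthant d n, fun ω' : Field d κ => endpoint ω n x * rowSum (ω' x)) =
      fun ω' => growth ω ω' n := by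
    ext ω'
    simp [growth]
  rw [hg, variance_eq_integral (measurable_growth_right n ω).aemeasurable,
    integral_growth ν hd hκ] at hsum
  rw [hsum, replicaOverlap, Finset.mul_sum]
  refine Finset.sum_congr rfl fun x _ => ?_
  rw [variance_const_mul, hvar, mul_comm]

/-- A quantitative strict concavity of log, whose linear term will integrate to zero when g has mean
c. -/
lemma log_sub_log_le {κ M g c : ℝ} (hκ : 0 < κ) (hg : κ ≤ g) (hgM : g ≤ M) (hc : κ ≤ c)
    (hcM : c ≤ M) :
    Real.log g - Real.log c ≤ (g - c) / c - (1 / (M * (M / κ + 1))) ^ 2 * (g - c) ^ 2 := by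
  have hc0 : 0 < c := hκ.trans_le hc
  have hg0 : 0 < g := hκ.trans_le hg
  have hM0 : 0 < M := hc0.trans_le hcM
  -- With s² = g/c, log(g/c) ≤ 2(s - 1) = (s² - 1) - (s - 1)². As (g - c)² = c²(s + 1)²(s - 1)²,
  -- bounding c(s + 1) by M(M/κ + 1) gives the constant.
  set s := Real.sqrt (g / c) with hs
  have hs0 : 0 < s := Real.sqrt_pos.mpr (by positivity)
  have hs2 : s ^ 2 = g / c := Real.sq_sqrt (by positivity)
  have hgs : g = c * s ^ 2 := by rw [hs2]; field_simp
  have hlog : Real.log g - Real.log c ≤ 2 * (s - 1) := by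
    rw [← Real.log_div hg0.ne' hc0.ne', ← hs2, Real.log_pow]
    have := Real.log_le_sub_one_of_pos hs0
    push_cast
    linarith
  have hMκ : 1 ≤ M / κ := (one_le_div hκ).mpr (hc.trans hcM)
  have hsM : s ≤ M / κ := by
    refine Real.sqrt_le_iff.mpr ⟨by positivity, ?_⟩
    calc g / c ≤ M / κ := div_le_div₀ hM0.le hgM hκ hc
      _ ≤ (M / κ) ^ 2 := by nlinarith
  have hquot : c * (s + 1) * (1 / (M * (M / κ + 1))) ≤ 1 := by
    rw [mul_one_div, div_le_one (by positivity)]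
    exact mul_le_mul hcM (by linarith) (by positivity) hM0.le
  have hsq : (c * (s + 1) * (1 / (M * (M / κ + 1)))) ^ 2 ≤ 1 := pow_le_one₀ (by positivity) hquot
  have h1 : (g - c) / c = s ^ 2 - 1 := by rw [hs2]; field_simp
  have h2 : (1 / (M * (M / κ + 1))) ^ 2 * (g - c) ^ 2 =
      (c * (s + 1) * (1 / (M * (M / κ + 1)))) ^ 2 * (s - 1) ^ 2 := by
    rw [hgs]
    ring
  rw [h1, h2]
  nlinarith [mul_le_mul_of_nonneg_right hsq (sq_nonneg (s - 1))]

/-- From log r ≥ 1 - 1/r at r = g/c, whose quadratic remainder is (g - c)²/(gc). -/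
lemma le_log_sub_log {κ g c : ℝ} (hκ : 0 < κ) (hg : κ ≤ g) (hc : κ ≤ c) :
    (g - c) / c - (1 / κ) ^ 2 * (g - c) ^ 2 ≤ Real.log g - Real.log c := by
  have hc0 : 0 < c := hκ.trans_le hc
  have hg0 : 0 < g := hκ.trans_le hg
  have h1 := Real.one_sub_inv_le_log_of_pos (div_pos hg0 hc0)
  rw [Real.log_div hg0.ne' hc0.ne'] at h1
  refine le_trans ?_ h1
  have h2 : 1 - (g / c)⁻¹ = (g - c) / c - 1 / (g * c) * (g - c) ^ 2 := by
    field_simp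
    ring
  rw [h2]
  have h3 : 1 / (g * c) ≤ (1 / κ) ^ 2 := by
    rw [one_div_pow, sq]
    exact one_div_le_one_div_of_le (by positivity) (mul_le_mul hg hc hκ.le hg0.le)
  nlinarith [mul_le_mul_of_nonneg_right h3 (sq_nonneg (g - c))]

lemma integrable_growth_sub_sq (hd : 0 < d) (hκ : 0 < κ) (ω : Field d κ) (n : ℕ) (b : ℝ) :
    Integrable (fun ω' => (growth ω ω' n - b) ^ 2) (fieldLaw ν) :=
  integrable_of_abs_le (((measurable_growth_right n ω).sub_const b).pow_const 2)
    (C := (d + |b|) ^ 2) fun ω' => by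
      rw [abs_pow]
      refine pow_le_pow_left₀ (abs_nonneg _) ((abs_sub _ _).trans ?_) 2
      rw [abs_of_nonneg (hκ.le.trans (le_growth hd hκ ω ω' n))]
      exact add_le_add_left (growth_le hd hκ ω ω' n) _

lemma integrable_growth (hd : 0 < d) (hκ : 0 < κ) (ω : Field d κ) (n : ℕ) :
    Integrable (fun ω' => growth ω ω' n) (fieldLaw ν) :=
  integrable_of_abs_le (measurable_growth_right n ω) (C := d) fun ω' => by
    rw [abs_of_nonneg (hκ.le.trans (le_growth hd hκ ω ω' n))]
    exact growth_le hd hκ ω ω' n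

lemma integral_quadratic_growth (hd : 0 < d) (hκ : 0 < κ) (ω : Field d κ) (n : ℕ) (A : ℝ) :
    Integrable (fun ω' => (growth ω ω' n - meanWeight ν) / meanWeight ν -
      A * (growth ω ω' n - meanWeight ν) ^ 2) (fieldLaw ν) ∧
    ∫ ω', ((growth ω ω' n - meanWeight ν) / meanWeight ν -
      A * (growth ω ω' n - meanWeight ν) ^ 2) ∂(fieldLaw ν) =
        -(A * (varWeight ν * replicaOverlap ω n)) := by
  have h1 : Integrable (fun ω' => (growth ω ω' n - meanWeight ν) / meanWeight ν) (fieldLaw ν) :=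
    ((integrable_growth ν hd hκ ω n).sub (integrable_const _)).div_const _
  have h2 := (integrable_growth_sub_sq ν hd hκ ω n (meanWeight ν)).const_mul A
  refine ⟨h1.sub h2, ?_⟩
  rw [integral_sub h1 h2, integral_const_mul, integral_growth_sub_sq ν hd hκ, integral_div,
    integral_sub (integrable_growth ν hd hκ ω n) (integrable_const _), integral_growth ν hd hκ]
  simp

lemma integral_log_growth_sub (hd : 0 < d) (hκ : 0 < κ) (ω : Field d κ) (n : ℕ) :
    Integrable (fun ω' => Real.log (growth ω ω' n) - Real.log (meanWeight ν)) (fieldLaw ν) ∧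
    ∫ ω', (Real.log (growth ω ω' n) - Real.log (meanWeight ν)) ∂(fieldLaw ν) =
      drift ν n ω - Real.log (meanWeight ν) := by
  have h1 : Integrable (fun ω' => Real.log (growth ω ω' n)) (fieldLaw ν) :=
    integrable_of_abs_le (measurable_growth_right n ω).log
      fun ω' => abs_log_growth_le hd hκ ω ω' n
  refine ⟨h1.sub (integrable_const _), ?_⟩
  rw [integral_sub h1 (integrable_const _)]
  simp [drift]

/-- The gap between the annealed growth rate and the drift dominates the replica overlap. -/
lemma replicaOverlap_le_gap (hd : 0 < d) (hκ : 0 < κ) (ω : Field d κ) (n : ℕ) :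
    (1 / (d * (d / κ + 1))) ^ 2 * (varWeight ν * replicaOverlap ω n) ≤
      Real.log (meanWeight ν) - drift ν n ω := by
  obtain ⟨hi1, he1⟩ := integral_log_growth_sub ν hd hκ ω n
  obtain ⟨hi2, he2⟩ := integral_quadratic_growth ν hd hκ ω n ((1 / (d * (d / κ + 1))) ^ 2)
  have := integral_mono hi1 hi2 fun ω' => log_sub_log_le hκ (le_growth hd hκ ω ω' n)
    (growth_le hd hκ ω ω' n) (le_meanWeight ν hd hκ) (meanWeight_le ν hd hκ)
  rw [he1, he2] at this
  linarith

/-- The gap between the annealed growth rate and the drift is dominated by the replica overlap. -/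
lemma gap_le_replicaOverlap (hd : 0 < d) (hκ : 0 < κ) (ω : Field d κ) (n : ℕ) :
    Real.log (meanWeight ν) - drift ν n ω ≤
      (1 / κ) ^ 2 * (varWeight ν * replicaOverlap ω n) := by
  obtain ⟨hi1, he1⟩ := integral_log_growth_sub ν hd hκ ω n
  obtain ⟨hi2, he2⟩ := integral_quadratic_growth ν hd hκ ω n ((1 / κ) ^ 2)
  have := integral_mono hi2 hi1 fun ω' =>
    le_log_sub_log hκ (le_growth hd hκ ω ω' n) (le_meanWeight ν hd hκ)
  rw [he1, he2] at this
  linarith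

lemma varWeight_nonneg (ν : Measure (WeightVec d κ)) : 0 ≤ varWeight ν := variance_nonneg _ _

/-- The averaged gaps converge to the difference of the free energies. -/
lemma ae_tendsto_avg_gap (hd : 0 < d) (hκ : 0 < κ) {p : ℝ} (hp : ∀ᵐ ω ∂(fieldLaw ν),
      Tendsto (fun n : ℕ => Real.log (partition ω n) / n) atTop (𝓝 p)) :
    ∀ᵐ ω ∂(fieldLaw ν), Tendsto (fun n : ℕ =>
      (∑ k ∈ Finset.range n, (Real.log (meanWeight ν) - drift ν k ω)) / n) atTop
        (𝓝 (Real.log (meanWeight ν) - p)) := by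
  filter_upwards [hp, ae_tendsto_log_partition_sub_sum_drift ν hd hκ] with ω h1 h2
  have h3 := (tendsto_const_nhds (x := Real.log (meanWeight ν))).sub (h1.sub h2)
  rw [sub_zero] at h3
  refine h3.congr' ?_
  filter_upwards [eventually_ge_atTop 1] with n hn
  have hn' : (n : ℝ) ≠ 0 := by positivity
  rw [Finset.sum_sub_distrib, Finset.sum_const, Finset.card_range, nsmul_eq_mul]
  field_simp
  ring

theorem freeEnergy_le (hd : 0 < d) (hκ : 0 < κ) {p : ℝ} (hp : ∀ᵐ ω ∂(fieldLaw ν),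
      Tendsto (fun n : ℕ => Real.log (partition ω n) / n) atTop (𝓝 p)) :
    p ≤ Real.log (meanWeight ν) := by
  obtain ⟨ω, hω⟩ := (ae_tendsto_avg_gap ν hd hκ hp).exists
  refine sub_nonneg.mp (ge_of_tendsto' hω fun n => ?_)
  refine div_nonneg (Finset.sum_nonneg fun k _ => le_trans ?_ (replicaOverlap_le_gap ν hd hκ ω k))
    (Nat.cast_nonneg n)
  have := varWeight_nonneg ν
  have := replicaOverlap_nonneg ω k
  positivity

/-! ### From the gap to localization and delocalization -/

/-- The Cesàro averages of the largest endpoint probabilities. -/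
def avgMaxEndpoint (ω : Field d κ) (n : ℕ) : ℝ := (∑ k ∈ Finset.range n, maxEndpoint ω k) / n

/-- The Cesàro averages of the replica overlaps. -/
def avgOverlap (ω : Field d κ) (n : ℕ) : ℝ := (∑ k ∈ Finset.range n, replicaOverlap ω k) / n

lemma avgMaxEndpoint_nonneg (hd : 0 < d) (hκ : 0 < κ) (ω : Field d κ) (n : ℕ) :
    0 ≤ avgMaxEndpoint ω n :=
  div_nonneg (Finset.sum_nonneg fun k _ => maxEndpoint_nonneg hd hκ ω k) (Nat.cast_nonneg n)

lemma avgMaxEndpoint_le_one (hd : 0 < d) (hκ : 0 < κ) (ω : Field d κ) (n : ℕ) :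
    avgMaxEndpoint ω n ≤ 1 := by
  refine div_le_one_of_le₀ ?_ (Nat.cast_nonneg n)
  exact (Finset.sum_le_sum fun k _ => maxEndpoint_le_one hd hκ ω k).trans (by simp)

lemma avgOverlap_nonneg (ω : Field d κ) (n : ℕ) : 0 ≤ avgOverlap ω n :=
  div_nonneg (Finset.sum_nonneg fun k _ => replicaOverlap_nonneg ω k) (Nat.cast_nonneg n)

/-- Cauchy–Schwarz over time, combined with the bound of the squared maximum by the overlap. -/
lemma avgMaxEndpoint_le_sqrt (hd : 0 < d) (hκ : 0 < κ) (ω : Field d κ) (n : ℕ) :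
    avgMaxEndpoint ω n ≤ Real.sqrt (avgOverlap ω n) := by
  refine Real.le_sqrt_of_sq_le ?_
  rcases Nat.eq_zero_or_pos n with rfl | hn
  · simp [avgMaxEndpoint, avgOverlap]
  have hn' : (0 : ℝ) < n := by exact_mod_cast hn
  have h1 := sq_sum_le_card_mul_sum_sq (s := Finset.range n) (f := maxEndpoint ω)
  rw [Finset.card_range] at h1
  have h2 := Finset.sum_le_sum fun k (_ : k ∈ Finset.range n) => maxEndpoint_sq_le hd hκ ω k
  rw [avgMaxEndpoint, avgOverlap, div_pow, div_le_div_iff₀ (by positivity) hn']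
  nlinarith

/-- Delocalization is a statement about a liminf, so control along one sequence of times suffices;
the degenerate case provides no more. -/
lemma liminf_avgMaxEndpoint_eq_zero (hd : 0 < d) (hκ : 0 < κ) {ω : Field d κ} {φ : ℕ → ℕ}
    (hφ : Tendsto φ atTop atTop)
    (h : Tendsto (fun n => avgOverlap ω (φ n)) atTop (𝓝 0)) :
    liminf (avgMaxEndpoint ω) atTop = 0 := by
  have hbelow : IsBoundedUnder (· ≥ ·) atTop (avgMaxEndpoint ω) :=
    isBoundedUnder_of ⟨0, avgMaxEndpoint_nonneg hd hκ ω⟩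
  have habove : IsBoundedUnder (· ≤ ·) atTop (avgMaxEndpoint ω) :=
    isBoundedUnder_of ⟨1, avgMaxEndpoint_le_one hd hκ ω⟩
  refine le_antisymm (le_of_forall_pos_le_add fun ε hε => ?_)
    (le_liminf_of_le habove.isCoboundedUnder_ge
      (Eventually.of_forall (avgMaxEndpoint_nonneg hd hκ ω)))
  rw [zero_add]
  refine liminf_le_of_frequently_le (hφ.frequently (Eventually.frequently ?_)) hbelow
  have hs := h.sqrt
  rw [Real.sqrt_zero] at hs
  filter_upwards [hs.eventually (gt_mem_nhds hε)] with n hn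
  exact (avgMaxEndpoint_le_sqrt hd hκ ω (φ n)).trans hn.le

/-- A strict gap between the free energies forces localization of the endpoint. -/
theorem ae_liminf_avgMaxEndpoint_pos (hd : 0 < d) (hκ : 0 < κ) {p : ℝ}
    (hp : ∀ᵐ ω ∂(fieldLaw ν),
      Tendsto (fun n : ℕ => Real.log (partition ω n) / n) atTop (𝓝 p))
    (hlt : p < Real.log (meanWeight ν)) :
    ∀ᵐ ω ∂(fieldLaw ν), 0 < liminf (avgMaxEndpoint ω) atTop := by
  filter_upwards [ae_tendsto_avg_gap ν hd hκ hp] with ω hω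
  set L := Real.log (meanWeight ν) - p with hL
  have hL0 : 0 < L := sub_pos.mpr hlt
  set B := (1 / κ) ^ 2 * varWeight ν with hB
  have hB0 : 0 ≤ B := mul_nonneg (sq_nonneg _) (varWeight_nonneg ν)
  have habove : IsBoundedUnder (· ≤ ·) atTop (avgMaxEndpoint ω) :=
    isBoundedUnder_of ⟨1, avgMaxEndpoint_le_one hd hκ ω⟩
  -- The averaged gap is eventually above L/2 and at most B times the averaged maximum; the extra 1
  -- keeps the denominator positive without knowing B ≠ 0.
  have hpos : 0 < L / 2 / (B + 1) := by positivity
  refine hpos.trans_le (le_liminf_of_le habove.isCoboundedUnder_ge ?_)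
  filter_upwards [hω.eventually (lt_mem_nhds (half_lt_self hL0))] with n hn
  rw [div_le_iff₀ (by positivity)]
  have h1 : (∑ k ∈ Finset.range n, (Real.log (meanWeight ν) - drift ν k ω)) / n ≤
      B * avgMaxEndpoint ω n := by
    rw [avgMaxEndpoint, ← mul_div_assoc, Finset.mul_sum]
    refine div_le_div_of_nonneg_right (Finset.sum_le_sum fun k _ => ?_) (Nat.cast_nonneg n)
    refine (gap_le_replicaOverlap ν hd hκ ω k).trans ?_
    rw [← mul_assoc]
    exact mul_le_mul_of_nonneg_left (replicaOverlap_le_maxEndpoint hd hκ ω k) hB0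
  have h2 := avgMaxEndpoint_nonneg hd hκ ω n
  nlinarith

lemma ae_tendsto_avgOverlap (hd : 0 < d) (hκ : 0 < κ)
    (hp : ∀ᵐ ω ∂(fieldLaw ν), Tendsto (fun n : ℕ => Real.log (partition ω n) / n) atTop
      (𝓝 (Real.log (meanWeight ν)))) (hv : 0 < varWeight ν) :
    ∀ᵐ ω ∂(fieldLaw ν), Tendsto (avgOverlap ω) atTop (𝓝 0) := by
  filter_upwards [ae_tendsto_avg_gap ν hd hκ hp] with ω hω
  rw [sub_self] at hω
  have hd' : (0 : ℝ) < d := by exact_mod_cast hd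
  set A := (1 / (d * (d / κ + 1))) ^ 2 * varWeight ν with hA
  have hA0 : 0 < A := by positivity
  have h1 := hω.const_mul A⁻¹
  rw [mul_zero] at h1
  refine squeeze_zero (avgOverlap_nonneg ω) (fun n => ?_) h1
  rw [avgOverlap, ← mul_div_assoc]
  refine div_le_div_of_nonneg_right ?_ (Nat.cast_nonneg n)
  rw [Finset.mul_sum]
  refine Finset.sum_le_sum fun k _ => ?_
  rw [le_inv_mul_iff₀ hA0, hA, mul_assoc]
  exact replicaOverlap_le_gap ν hd hκ ω k

/-! ### Two replicas, and the case of a deterministic total weight -/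

/-- The mean of `f` over the difference of two replicas of the endpoint. -/
def pairMean (ω : Field d κ) (n : ℕ) (f : Site d → ℝ) : ℝ :=
  ∑ x ∈ orthant d n, ∑ y ∈ orthant d n, endpoint ω n x * endpoint ω n y * f (x - y)

/-- The total weight of `f` over pairs of steps from the sites `x` and `y`. -/
def siteStep (ω : Field d κ) (x y : Site d) (f : Site d → ℝ) : ℝ :=
  ∑ i, ∑ j, (ω x).1 i * (ω y).1 j * f (x + unitVec i - (y + unitVec j))

/-- The total weight of `f` after one more step in `ω'` of two replicas of the endpoint in `ω`. -/
def pairStep (ω ω' : Field d κ) (n : ℕ) (f : Site d → ℝ) : ℝ :=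
  ∑ x ∈ orthant d n, ∑ y ∈ orthant d n, endpoint ω n x * endpoint ω n y * siteStep ω' x y f

lemma sum_endpoint_succ (hd : 0 < d) (hκ : 0 < κ) (ω : Field d κ) (n : ℕ) (f : Site d → ℝ) :
    growth ω ω n * ∑ y ∈ orthant d (n + 1), endpoint ω (n + 1) y * f y =
      ∑ x ∈ orthant d n, endpoint ω n x * ∑ i, (ω x).1 i * f (x + unitVec i) := by
  have h := sum_mass_succ ω n f
  have hZ := (partition_pos hd hκ ω n).ne'
  have hg := (hκ.trans_le (le_growth hd hκ ω ω n)).ne'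
  simp only [endpoint, div_mul_eq_mul_div]
  rw [← Finset.sum_div, ← Finset.sum_div, h, partition_succ_eq_mul_growth hd hκ]
  field_simp

/-- The replicas step independently in the same environment, and each contributes one normalizing
factor `growth`. -/
lemma pairMean_succ (hd : 0 < d) (hκ : 0 < κ) (ω : Field d κ) (n : ℕ) (f : Site d → ℝ) :
    growth ω ω n ^ 2 * pairMean ω (n + 1) f = pairStep ω ω n f := by
  have h1 : pairMean ω (n + 1) f = ∑ x ∈ orthant d (n + 1), endpoint ω (n + 1) x *
      ∑ y ∈ orthant d (n + 1), endpoint ω (n + 1) y * f (x - y) := by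
    simp only [pairMean, Finset.mul_sum, mul_assoc]
  have h2 : ∀ x, growth ω ω n *
      ∑ i, (ω x).1 i * (∑ y ∈ orthant d (n + 1), endpoint ω (n + 1) y * f (x + unitVec i - y)) =
      ∑ y ∈ orthant d n, endpoint ω n y * siteStep ω x y f := by
    intro x
    rw [Finset.mul_sum]
    simp only [mul_left_comm (growth ω ω n), sum_endpoint_succ hd hκ ω n]
    simp only [siteStep, Finset.mul_sum]
    rw [Finset.sum_comm]
    refine Finset.sum_congr rfl fun y _ => Finset.sum_congr rfl fun i _ =>
      Finset.sum_congr rfl fun j _ => ?_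
    ring
  rw [h1, sq, mul_assoc, sum_endpoint_succ hd hκ ω n
    (fun x => ∑ y ∈ orthant d (n + 1), endpoint ω (n + 1) y * f (x - y)), Finset.mul_sum]
  simp only [mul_left_comm (growth ω ω n), h2]
  simp only [pairStep, Finset.mul_sum, mul_assoc]

lemma measurable_siteStep (x y : Site d) (f : Site d → ℝ) :
    Measurable fun ω : Field d κ => siteStep ω x y f :=
  Finset.measurable_sum _ fun i _ => Finset.measurable_sum _ fun j _ =>
    ((measurable_weight x i).mul (measurable_weight y j)).mul_const _

lemma abs_weight_le_one (hκ : 0 < κ) (s : WeightVec d κ) (i : Fin d) : |s.1 i| ≤ 1 := by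
  rw [abs_of_nonneg (hκ.le.trans (s.2 i).1)]
  exact (s.2 i).2

lemma abs_siteStep_le (hκ : 0 < κ) (ω : Field d κ) (x y : Site d) (f : Site d → ℝ) :
    |siteStep ω x y f| ≤ ∑ i, ∑ j, |f (x + unitVec i - (y + unitVec j))| := by
  refine (Finset.abs_sum_le_sum_abs _ _).trans (Finset.sum_le_sum fun i _ => ?_)
  refine (Finset.abs_sum_le_sum_abs _ _).trans (Finset.sum_le_sum fun j _ => ?_)
  rw [abs_mul, abs_mul]
  refine mul_le_of_le_one_left (abs_nonneg _) ?_
  exact mul_le_one₀ (abs_weight_le_one hκ _ _) (abs_nonneg _) (abs_weight_le_one hκ _ _)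

lemma integrable_siteStep (hκ : 0 < κ) (x y : Site d) (f : Site d → ℝ) :
    Integrable (fun ω => siteStep ω x y f) (fieldLaw ν) :=
  integrable_of_abs_le (measurable_siteStep x y f) fun ω => abs_siteStep_le hκ ω x y f

lemma integrable_endpoint_mul_endpoint_mul (hd : 0 < d) (hκ : 0 < κ) (n : ℕ) (x y : Site d)
    {g : Field d κ → ℝ} (hg : Measurable g) {C : ℝ} (hC : ∀ ω, |g ω| ≤ C) :
    Integrable (fun ω => endpoint ω n x * endpoint ω n y * g ω) (fieldLaw ν) := by
  refine integrable_of_abs_le (((measurable_endpoint n x).mul (measurable_endpoint n y)).mul hg)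
    (C := C) fun ω => ?_
  rw [abs_mul, abs_mul, abs_of_nonneg (endpoint_nonneg hd hκ ω n x),
    abs_of_nonneg (endpoint_nonneg hd hκ ω n y)]
  refine (mul_le_of_le_one_left (abs_nonneg _) ?_).trans (hC ω)
  exact mul_le_one₀ (endpoint_le_one hd hκ ω n x) (endpoint_nonneg hd hκ ω n y)
    (endpoint_le_one hd hκ ω n y)

lemma integrable_pairMean (hd : 0 < d) (hκ : 0 < κ) (n : ℕ) (f : Site d → ℝ) :
    Integrable (fun ω => pairMean ω n f) (fieldLaw ν) :=
  integrable_finsetSum _ fun x _ => integrable_finsetSum _ fun y _ =>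
    integrable_endpoint_mul_endpoint_mul ν hd hκ n x y measurable_const (C := |f (x - y)|)
      fun _ => le_rfl

/-- The endpoint masses read levels below `n` and the steps read level `n`, so the step may be
averaged with the endpoints frozen. -/
lemma integral_pairStep (hd : 0 < d) (hκ : 0 < κ) (n : ℕ) (f : Site d → ℝ) :
    ∫ ω, pairStep ω ω n f ∂(fieldLaw ν) = ∫ ω, ∑ x ∈ orthant d n, ∑ y ∈ orthant d n,
      endpoint ω n x * endpoint ω n y * ∫ ω', siteStep ω' x y f ∂(fieldLaw ν) ∂(fieldLaw ν) := by
  have hm : Measurable fun ω : Field d κ => pairStep ω ω n f :=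
    Finset.measurable_sum _ fun x _ => Finset.measurable_sum _ fun y _ =>
      ((measurable_endpoint n x).mul (measurable_endpoint n y)).mul (measurable_siteStep x y f)
  have hi : Integrable (fun ω => pairStep ω ω n f) (fieldLaw ν) :=
    integrable_finsetSum _ fun x _ => integrable_finsetSum _ fun y _ =>
      integrable_endpoint_mul_endpoint_mul ν hd hκ n x y (measurable_siteStep x y f)
        fun ω => abs_siteStep_le hκ ω x y f
  rw [← integral_glue_of_integrable ν n hm hi]
  refine integral_congr_ae (ae_of_all _ fun ω => ?_)
  have hglue : ∀ ω', pairStep (glue n ω ω') (glue n ω ω') n f =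
      ∑ x ∈ orthant d n, ∑ y ∈ orthant d n,
        endpoint ω n x * endpoint ω n y * siteStep ω' x y f := by
    intro ω'
    refine Finset.sum_congr rfl fun x hx => Finset.sum_congr rfl fun y hy => ?_
    have he : ∀ z, endpoint (glue n ω ω') n z = endpoint ω n z := fun z =>
      endpoint_congr (fun _ _ h => glue_of_lt h _ _) z
    rw [he, he]
    simp only [siteStep]
    rw [glue_of_le (mem_orthant.mp hx).2.ge, glue_of_le (mem_orthant.mp hy).2.ge]
  dsimp only
  simp only [hglue]
  rw [integral_finsetSum _ fun x _ => integrable_finsetSum _ fun y _ =>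
    (integrable_siteStep ν hκ x y f).const_mul _]
  refine Finset.sum_congr rfl fun x _ => ?_
  rw [integral_finsetSum _ fun y _ => (integrable_siteStep ν hκ x y f).const_mul _]
  simp only [integral_const_mul]

lemma replicaOverlap_eq (ω : Field d κ) (n : ℕ) :
    replicaOverlap ω n = ∑ x ∈ orthant d n, ∑ y ∈ orthant d n,
      endpoint ω n x * endpoint ω n y * if x = y then 1 else 0 := by
  refine Finset.sum_congr rfl fun x hx => ?_
  simp [hx, sq]

lemma ae_rowSum_eq (hd : 0 < d) (hκ : 0 < κ) (hv : varWeight ν = 0) :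
    ∀ᵐ ω ∂(fieldLaw ν), ∀ x, rowSum (ω x) = meanWeight ν := by
  have hmem : MemLp rowSum 2 ν :=
    MemLp.of_bound measurable_rowSum.aestronglyMeasurable d (ae_of_all _ (abs_rowSum_le hd hκ))
  have h1 : ∀ᵐ s ∂ν, rowSum s = meanWeight ν := by
    have hz : evariance rowSum ν = 0 := by
      rw [← hmem.ofReal_variance_eq]
      rw [varWeight] at hv
      rw [hv, ENNReal.ofReal_zero]
    exact (evariance_eq_zero_iff measurable_rowSum.aemeasurable).mp hz
  rw [ae_all_iff]
  intro x
  have hmap : (fieldLaw ν).map (fun ω => ω x) = ν := Measure.infinitePi_map_eval _ x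
  have h2 : ∀ᵐ s ∂(fieldLaw ν).map (fun ω => ω x), rowSum s = meanWeight ν := hmap.symm ▸ h1
  exact ae_of_ae_map (measurable_pi_apply x).aemeasurable h2

/-- The difference along coordinate `o` as a real number. -/
def coordDiff (o : Fin d) (z : Site d) : ℝ := (z o : ℝ)

lemma coordDiff_step (o : Fin d) (x y : Site d) (i j : Fin d) :
    coordDiff o (x + unitVec i - (y + unitVec j)) =
      coordDiff o (x - y) + ((if i = o then 1 else 0) - if j = o then 1 else 0) := by
  simp only [coordDiff, unitVec, Pi.sub_apply, Pi.add_apply, Pi.single_apply, eq_comm (a := o)]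
  push_cast
  ring

lemma siteStep_coordDiff (o : Fin d) (ω : Field d κ) (x y : Site d) :
    siteStep ω x y (coordDiff o) = rowSum (ω x) * rowSum (ω y) * coordDiff o (x - y) +
      ((ω x).1 o * rowSum (ω y) - rowSum (ω x) * (ω y).1 o) := by
  simp only [siteStep, coordDiff_step, mul_add, mul_sub, Finset.sum_add_distrib,
    Finset.sum_sub_distrib, rowSum, Finset.sum_mul, Finset.mul_sum]
  simp only [mul_ite, mul_one, mul_zero, Finset.sum_ite_eq', Finset.mem_univ, if_true]
  rw [Finset.sum_comm]
  congr 1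
  simp

lemma integral_weight (x : Site d) (o : Fin d) :
    ∫ ω, (ω x).1 o ∂(fieldLaw ν) = ∫ s, s.1 o ∂ν :=
  integral_eval ν x ((measurable_pi_apply o).comp measurable_subtype_coe)

lemma integrable_weight (hκ : 0 < κ) (x : Site d) (o : Fin d) :
    Integrable (fun ω : Field d κ => (ω x).1 o) (fieldLaw ν) :=
  integrable_of_abs_le (measurable_weight x o) fun ω => abs_weight_le_one hκ (ω x) o

/-- The martingale property of the difference: with constant total weight the correction is
proportional to the difference of two weights with equal means. -/
lemma integral_siteStep_coordDiff (hd : 0 < d) (hκ : 0 < κ) (hv : varWeight ν = 0) (o : Fin d)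
    (x y : Site d) : ∫ ω, siteStep ω x y (coordDiff o) ∂(fieldLaw ν) =
      meanWeight ν ^ 2 * coordDiff o (x - y) := by
  have h : (fun ω => siteStep ω x y (coordDiff o)) =ᵐ[fieldLaw ν] fun ω =>
      meanWeight ν ^ 2 * coordDiff o (x - y) + meanWeight ν * ((ω x).1 o - (ω y).1 o) := by
    filter_upwards [ae_rowSum_eq ν hd hκ hv] with ω hω
    rw [siteStep_coordDiff, hω, hω]
    ring
  have hi : Integrable (fun ω : Field d κ => (ω x).1 o - (ω y).1 o) (fieldLaw ν) :=
    (integrable_weight ν hκ x o).sub (integrable_weight ν hκ y o)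
  rw [integral_congr_ae h, integral_add (integrable_const _) (hi.const_mul _),
    integral_const, integral_const_mul, integral_sub (integrable_weight ν hκ x o) (integrable_weight ν hκ y o),
    integral_weight, integral_weight]
  simp

/-- Off the diagonal this is |∫ f| ≤ ∫ |f| and the martingale property. On the diagonal the replicas
separate along `o` when one steps in direction `o` and the other does not; d ≥ 2 makes this
possible, with weight at least κ². -/
lemma integral_siteStep_abs_ge (hd : 2 ≤ d) (hκ : 0 < κ) (hv : varWeight ν = 0) (o : Fin d)
    (x y : Site d) :
    meanWeight ν ^ 2 * |coordDiff o (x - y)| + κ ^ 2 * (if x = y then 1 else 0) ≤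
      ∫ ω, siteStep ω x y (fun z => |coordDiff o z|) ∂(fieldLaw ν) := by
  have hd0 : 0 < d := by omega
  have hi := integrable_siteStep ν hκ x y (fun z => |coordDiff o z|)
  by_cases hxy : x = y
  · subst hxy
    have hz : coordDiff o (x - x) = 0 := by simp [coordDiff]
    have hge : ∀ ω : Field d κ, κ ^ 2 ≤ siteStep ω x x (fun z => |coordDiff o z|) := by
      intro ω
      have : Nontrivial (Fin d) := Fin.nontrivial_iff_two_le.mpr hd
      obtain ⟨j, hj⟩ := exists_ne o
      have hnn : ∀ i j', 0 ≤ (ω x).1 i * (ω x).1 j' *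
          |coordDiff o (x + unitVec i - (x + unitVec j'))| := fun i j' =>
        mul_nonneg (mul_nonneg (hκ.le.trans ((ω x).2 i).1) (hκ.le.trans ((ω x).2 j').1))
          (abs_nonneg _)
      have h1 := Finset.single_le_sum (f := fun i => ∑ j', (ω x).1 i * (ω x).1 j' *
          |coordDiff o (x + unitVec i - (x + unitVec j'))|)
        (fun i _ => Finset.sum_nonneg fun j' _ => hnn i j') (Finset.mem_univ o)
      have h2 := Finset.single_le_sum (f := fun j' => (ω x).1 o * (ω x).1 j' *
          |coordDiff o (x + unitVec o - (x + unitVec j'))|)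
        (fun j' _ => hnn o j') (Finset.mem_univ j)
      refine le_trans ?_ (h2.trans h1)
      rw [coordDiff_step, hz, if_pos rfl, if_neg hj, sq]
      simpa using mul_le_mul ((ω x).2 o).1 ((ω x).2 j).1 hκ.le (hκ.le.trans ((ω x).2 o).1)
    have := integral_mono (integrable_const (κ ^ 2)) hi hge
    rw [integral_const, probReal_univ, one_smul] at this
    rw [hz, abs_zero, mul_zero, zero_add, if_pos rfl, mul_one]
    exact this
  · have h := abs_integral_le_integral_abs (μ := fieldLaw ν)
      (f := fun ω => siteStep ω x y (coordDiff o))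
    rw [integral_siteStep_coordDiff ν hd0 hκ hv, abs_mul, abs_of_nonneg (sq_nonneg _)] at h
    rw [if_neg hxy, mul_zero, add_zero]
    refine h.trans (integral_mono (integrable_siteStep ν hκ x y (coordDiff o)).abs hi fun ω => ?_)
    refine (Finset.abs_sum_le_sum_abs _ _).trans (Finset.sum_le_sum fun i _ => ?_)
    refine (Finset.abs_sum_le_sum_abs _ _).trans (Finset.sum_le_sum fun j _ => ?_)
    rw [abs_mul, abs_of_nonneg (mul_nonneg (hκ.le.trans ((ω x).2 i).1)
      (hκ.le.trans ((ω y).2 j).1))]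

lemma integral_siteStep_sq_le (hd : 0 < d) (hκ : 0 < κ) (hv : varWeight ν = 0) (o : Fin d)
    (x y : Site d) :
    ∫ ω, siteStep ω x y (fun z => coordDiff o z ^ 2) ∂(fieldLaw ν) ≤
      meanWeight ν ^ 2 * (coordDiff o (x - y) ^ 2 + 1) := by
  -- If a is the old difference and δ its increment, then |δ| ≤ 1 gives (a + δ)² ≤ 1 - a² + 2a(a +
  -- δ), which is linear in the new difference.
  have hle : ∀ᵐ ω ∂(fieldLaw ν), siteStep ω x y (fun z => coordDiff o z ^ 2) ≤
      meanWeight ν ^ 2 * (1 - coordDiff o (x - y) ^ 2) +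
        2 * coordDiff o (x - y) * siteStep ω x y (coordDiff o) := by
    filter_upwards [ae_rowSum_eq ν hd hκ hv] with ω hω
    have h1 : meanWeight ν ^ 2 * (1 - coordDiff o (x - y) ^ 2) =
        ∑ i, ∑ j, (ω x).1 i * (ω y).1 j * (1 - coordDiff o (x - y) ^ 2) := by
      rw [sq]
      nth_rw 1 [← hω x]
      rw [← hω y]
      rw [rowSum, rowSum, Finset.sum_mul_sum]
      simp only [Finset.sum_mul]
    rw [h1, siteStep, siteStep, Finset.mul_sum, ← Finset.sum_add_distrib]
    refine Finset.sum_le_sum fun i _ => ?_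
    rw [Finset.mul_sum, ← Finset.sum_add_distrib]
    refine Finset.sum_le_sum fun j _ => ?_
    have hw : 0 ≤ (ω x).1 i * (ω y).1 j :=
      mul_nonneg (hκ.le.trans ((ω x).2 i).1) (hκ.le.trans ((ω y).2 j).1)
    rw [mul_left_comm, ← mul_add]
    refine mul_le_mul_of_nonneg_left ?_ hw
    rw [coordDiff_step]
    split_ifs <;> nlinarith
  have hi := (integrable_siteStep ν hκ x y (coordDiff o)).const_mul (2 * coordDiff o (x - y))
  refine (integral_mono_ae (integrable_siteStep ν hκ x y _)
    ((integrable_const _).add hi) hle).trans (le_of_eq ?_)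
  simp only [Pi.add_apply]
  rw [integral_add (integrable_const _) hi, integral_const, integral_const_mul,
    integral_siteStep_coordDiff ν hd hκ hv, probReal_univ, one_smul]
  ring

/-- A deterministic total weight makes `growth` almost surely constant, so the random normalization
leaves the integral. -/
lemma meanWeight_sq_mul_integral_pairMean_succ (hd : 0 < d) (hκ : 0 < κ) (hv : varWeight ν = 0)
    (n : ℕ) (f : Site d → ℝ) :
    meanWeight ν ^ 2 * ∫ ω, pairMean ω (n + 1) f ∂(fieldLaw ν) =
      ∫ ω, pairStep ω ω n f ∂(fieldLaw ν) := by
  rw [← integral_const_mul]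
  refine integral_congr_ae ?_
  filter_upwards [ae_rowSum_eq ν hd hκ hv] with ω hω
  rw [← pairMean_succ hd hκ]
  congr 2
  simp only [growth, hω]
  rw [← Finset.sum_mul, sum_endpoint hd hκ, one_mul]

lemma integrable_weighted_pairs (hd : 0 < d) (hκ : 0 < κ) (n : ℕ) (a : Site d → Site d → ℝ) :
    Integrable (fun ω => ∑ x ∈ orthant d n, ∑ y ∈ orthant d n,
      endpoint ω n x * endpoint ω n y * a x y) (fieldLaw ν) :=
  integrable_finsetSum _ fun x _ => integrable_finsetSum _ fun y _ =>
    integrable_endpoint_mul_endpoint_mul ν hd hκ n x y measurable_const (C := |a x y|)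
      fun _ => le_rfl

lemma integrable_replicaOverlap (hd : 0 < d) (hκ : 0 < κ) (n : ℕ) :
    Integrable (fun ω => replicaOverlap ω n) (fieldLaw ν) := by
  simp only [replicaOverlap_eq]
  exact integrable_weighted_pairs ν hd hκ n fun x y => if x = y then 1 else 0

lemma integral_abs_pairMean_succ_ge (hd : 2 ≤ d) (hκ : 0 < κ) (hv : varWeight ν = 0) (o : Fin d)
    (n : ℕ) :
    ∫ ω, pairMean ω n (fun z => |coordDiff o z|) ∂(fieldLaw ν) +
        κ ^ 2 / meanWeight ν ^ 2 * ∫ ω, replicaOverlap ω n ∂(fieldLaw ν) ≤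
      ∫ ω, pairMean ω (n + 1) (fun z => |coordDiff o z|) ∂(fieldLaw ν) := by
  have hd0 : 0 < d := by omega
  have hc : 0 < meanWeight ν := hκ.trans_le (le_meanWeight ν hd0 hκ)
  refine le_of_mul_le_mul_left ?_ (pow_pos hc 2)
  rw [meanWeight_sq_mul_integral_pairMean_succ ν hd0 hκ hv, integral_pairStep ν hd0 hκ, mul_add,
    ← mul_assoc, mul_div_cancel₀ _ (pow_pos hc 2).ne', ← integral_const_mul,
    ← integral_const_mul, ← integral_add ((integrable_pairMean ν hd0 hκ n _).const_mul _)
      ((integrable_replicaOverlap ν hd0 hκ n).const_mul _)]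
  refine integral_mono (((integrable_pairMean ν hd0 hκ n _).const_mul _).add
    ((integrable_replicaOverlap ν hd0 hκ n).const_mul _))
    (integrable_weighted_pairs ν hd0 hκ n _) fun ω => ?_
  simp only [pairMean, replicaOverlap_eq, Finset.mul_sum, ← Finset.sum_add_distrib]
  refine Finset.sum_le_sum fun x _ => Finset.sum_le_sum fun y _ => ?_
  rw [mul_left_comm, mul_left_comm (κ ^ 2), ← mul_add]
  exact mul_le_mul_of_nonneg_left (integral_siteStep_abs_ge ν hd hκ hv o x y)
    (mul_nonneg (endpoint_nonneg hd0 hκ _ _ _) (endpoint_nonneg hd0 hκ _ _ _))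

lemma pairMean_one (hd : 0 < d) (hκ : 0 < κ) (ω : Field d κ) (n : ℕ) :
    pairMean ω n (fun _ => 1) = 1 := by
  simp only [pairMean, mul_one, ← Finset.mul_sum, sum_endpoint hd hκ]

lemma integral_sq_pairMean_succ_le (hd : 0 < d) (hκ : 0 < κ) (hv : varWeight ν = 0) (o : Fin d)
    (n : ℕ) :
    ∫ ω, pairMean ω (n + 1) (fun z => coordDiff o z ^ 2) ∂(fieldLaw ν) ≤
      ∫ ω, pairMean ω n (fun z => coordDiff o z ^ 2) ∂(fieldLaw ν) + 1 := by
  have hc : 0 < meanWeight ν := hκ.trans_le (le_meanWeight ν hd hκ)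
  refine le_of_mul_le_mul_left ?_ (pow_pos hc 2)
  have h1 : ∫ ω, pairMean ω n (fun z => coordDiff o z ^ 2) ∂(fieldLaw ν) + 1 =
      ∫ ω, (pairMean ω n (fun z => coordDiff o z ^ 2) + pairMean ω n (fun _ => 1))
        ∂(fieldLaw ν) := by
    rw [integral_add (integrable_pairMean ν hd hκ n _) (integrable_pairMean ν hd hκ n _)]
    simp [pairMean_one hd hκ]
  rw [meanWeight_sq_mul_integral_pairMean_succ ν hd hκ hv, integral_pairStep ν hd hκ, h1,
    ← integral_const_mul]
  refine integral_mono (integrable_weighted_pairs ν hd hκ n _)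
    (((integrable_pairMean ν hd hκ n _).add (integrable_pairMean ν hd hκ n _)).const_mul _)
    fun ω => ?_
  simp only [pairMean, ← Finset.sum_add_distrib, Finset.mul_sum]
  refine Finset.sum_le_sum fun x _ => Finset.sum_le_sum fun y _ => ?_
  rw [← mul_add, mul_left_comm]
  exact mul_le_mul_of_nonneg_left (integral_siteStep_sq_le ν hd hκ hv o x y)
    (mul_nonneg (endpoint_nonneg hd hκ _ _ _) (endpoint_nonneg hd hκ _ _ _))

lemma pairMean_zero (ω : Field d κ) (f : Site d → ℝ) : pairMean ω 0 f = f 0 := by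
  simp [pairMean, endpoint, mass, partition_zero]

lemma integral_abs_pairMean_le_sqrt (hd : 0 < d) (hκ : 0 < κ) (hv : varWeight ν = 0) (o : Fin d)
    (n : ℕ) :
    ∫ ω, pairMean ω n (fun z => |coordDiff o z|) ∂(fieldLaw ν) ≤ Real.sqrt n := by
  have hsq : ∀ n : ℕ, ∫ ω, pairMean ω n (fun z => coordDiff o z ^ 2) ∂(fieldLaw ν) ≤ n := by
    intro n
    induction n with
    | zero => simp [pairMean_zero, coordDiff]
    | succ n ih =>
      have := integral_sq_pairMean_succ_le ν hd hκ hv o n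
      push_cast
      linarith
  rcases Nat.eq_zero_or_pos n with rfl | hn
  · simp [pairMean_zero, coordDiff]
  have hn' : (0 : ℝ) < n := by exact_mod_cast hn
  set A := Real.sqrt n with hA
  have hA0 : 0 < A := Real.sqrt_pos.mpr hn'
  have hA2 : A ^ 2 = n := Real.sq_sqrt hn'.le
  -- The inequality |z| ≤ z²/(2A) + A/2, with A = √n balancing the two terms.
  have hpt : ∀ ω : Field d κ, pairMean ω n (fun z => |coordDiff o z|) ≤
      (2 * A)⁻¹ * pairMean ω n (fun z => coordDiff o z ^ 2) + A / 2 * pairMean ω n (fun _ => 1) := by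
    intro ω
    simp only [pairMean, Finset.mul_sum, ← Finset.sum_add_distrib]
    refine Finset.sum_le_sum fun x _ => Finset.sum_le_sum fun y _ => ?_
    rw [mul_left_comm, mul_left_comm (A / 2), ← mul_add]
    refine mul_le_mul_of_nonneg_left ?_
      (mul_nonneg (endpoint_nonneg hd hκ _ _ _) (endpoint_nonneg hd hκ _ _ _))
    rw [← sq_abs, ← sub_nonneg]
    have : (2 * A)⁻¹ * |coordDiff o (x - y)| ^ 2 + A / 2 * 1 - |coordDiff o (x - y)| =
        (2 * A)⁻¹ * (|coordDiff o (x - y)| - A) ^ 2 := by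
      field_simp
      ring
    rw [this]
    positivity
  have hi := integrable_pairMean ν hd hκ n
  have h := integral_mono (hi _) (((hi _).const_mul _).add ((hi _).const_mul _)) hpt
  simp only [Pi.add_apply] at h
  rw [integral_add ((hi _).const_mul _) ((hi _).const_mul _), integral_const_mul,
    integral_const_mul] at h
  simp only [pairMean_one hd hκ, integral_const, probReal_univ, one_smul, mul_one] at h
  have h2 := mul_le_mul_of_nonneg_left (hsq n) (inv_nonneg.mpr (by positivity : 0 ≤ 2 * A))
  have h3 : (2 * A)⁻¹ * (n : ℝ) = A / 2 := by
    rw [← hA2]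
    field_simp
  linarith

/-- Each overlap is paid for by a gain in mean modulus, and the total gain up to time `n` is at most
√n. -/
lemma integral_avgOverlap_le (hd : 2 ≤ d) (hκ : 0 < κ) (hv : varWeight ν = 0) (n : ℕ) :
    ∫ ω, avgOverlap ω n ∂(fieldLaw ν) ≤
      meanWeight ν ^ 2 / κ ^ 2 * (Real.sqrt n)⁻¹ := by
  have hd0 : 0 < d := by omega
  have hc : 0 < meanWeight ν := hκ.trans_le (le_meanWeight ν hd0 hκ)
  set o : Fin d := ⟨0, hd0⟩
  have htel : ∀ n : ℕ, κ ^ 2 / meanWeight ν ^ 2 *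
      ∑ k ∈ Finset.range n, ∫ ω, replicaOverlap ω k ∂(fieldLaw ν) ≤
        ∫ ω, pairMean ω n (fun z => |coordDiff o z|) ∂(fieldLaw ν) := by
    intro n
    induction n with
    | zero => simp [pairMean_zero, coordDiff]
    | succ n ih =>
      have := integral_abs_pairMean_succ_ge ν hd hκ hv o n
      rw [Finset.sum_range_succ, mul_add]
      linarith
  have h := (htel n).trans (integral_abs_pairMean_le_sqrt ν hd0 hκ hv o n)
  simp only [avgOverlap]
  rw [integral_div, integral_finsetSum _ fun k _ => integrable_replicaOverlap ν hd0 hκ k]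
  have h2 : ∑ k ∈ Finset.range n, ∫ ω, replicaOverlap ω k ∂(fieldLaw ν) ≤
      meanWeight ν ^ 2 / κ ^ 2 * Real.sqrt n := by
    rw [div_mul_eq_mul_div, div_le_iff₀ (by positivity)] at h
    rw [div_mul_eq_mul_div, le_div_iff₀ (by positivity)]
    linarith
  calc _ ≤ meanWeight ν ^ 2 / κ ^ 2 * Real.sqrt n / n :=
        div_le_div_of_nonneg_right h2 (Nat.cast_nonneg n)
    _ = _ := by rw [mul_div_assoc, Real.sqrt_div_self', one_div]

/-- If the total outgoing weight is deterministic then the replica overlaps vanish on average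
along a subsequence. -/
lemma exists_seq_ae_tendsto_avgOverlap (hd : 2 ≤ d) (hκ : 0 < κ) (hv : varWeight ν = 0) :
    ∃ φ : ℕ → ℕ, StrictMono φ ∧ ∀ᵐ ω ∂(fieldLaw ν),
      Tendsto (fun n => avgOverlap ω (φ n)) atTop (𝓝 0) := by
  have hd0 : 0 < d := by omega
  have hm : ∀ n, Measurable fun ω : Field d κ => avgOverlap ω n := fun n =>
    (Finset.measurable_sum _ fun k _ => measurable_replicaOverlap k).div_const _
  have hi : ∀ n, Integrable (fun ω => avgOverlap ω n) (fieldLaw ν) := fun n =>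
    (integrable_finsetSum _ fun k _ => integrable_replicaOverlap ν hd0 hκ k).div_const _
  have h0 : Tendsto (fun n => ∫ ω, avgOverlap ω n ∂(fieldLaw ν)) atTop (𝓝 0) := by
    refine squeeze_zero (fun n => integral_nonneg fun ω => avgOverlap_nonneg ω n)
      (integral_avgOverlap_le ν hd hκ hv) ?_
    have : Tendsto (fun n : ℕ => (Real.sqrt n)⁻¹) atTop (𝓝 0) :=
      tendsto_inv_atTop_zero.comp (Real.tendsto_sqrt_atTop.comp tendsto_natCast_atTop_atTop)
    simpa using this.const_mul (meanWeight ν ^ 2 / κ ^ 2)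
  have hLp : Tendsto (fun n => eLpNorm ((fun ω => avgOverlap ω n) - fun _ => (0 : ℝ)) 1
      (fieldLaw ν)) atTop (𝓝 0) := by
    have := ENNReal.tendsto_ofReal h0
    rw [ENNReal.ofReal_zero] at this
    refine this.congr fun n => ?_
    rw [eLpNorm_one_eq_lintegral_enorm, ofReal_integral_eq_lintegral_ofReal (hi n)
      (ae_of_all _ fun ω => avgOverlap_nonneg ω n)]
    refine lintegral_congr fun ω => ?_
    rw [Pi.sub_apply, sub_zero, Real.enorm_eq_ofReal (avgOverlap_nonneg ω n)]
  exact (tendstoInMeasure_of_tendsto_eLpNorm one_ne_zero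
    (fun n => (hm n).aestronglyMeasurable) aestronglyMeasurable_const hLp).exists_seq_tendsto_ae

/-- Equality of the free energies forces delocalization of the endpoint. -/
theorem ae_liminf_avgMaxEndpoint_eq_zero (hd : 2 ≤ d) (hκ : 0 < κ)
    (hp : ∀ᵐ ω ∂(fieldLaw ν), Tendsto (fun n : ℕ => Real.log (partition ω n) / n) atTop
      (𝓝 (Real.log (meanWeight ν)))) :
    ∀ᵐ ω ∂(fieldLaw ν), liminf (avgMaxEndpoint ω) atTop = 0 := by
  have hd0 : 0 < d := by omega
  rcases (varWeight_nonneg ν).eq_or_lt with hv | hv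
  · obtain ⟨φ, hφ, h⟩ := exists_seq_ae_tendsto_avgOverlap ν hd hκ hv.symm
    filter_upwards [h] with ω hω
    exact liminf_avgMaxEndpoint_eq_zero hd0 hκ hφ.tendsto_atTop hω
  · filter_upwards [ae_tendsto_avgOverlap ν hd0 hκ hp hv] with ω hω
    exact liminf_avgMaxEndpoint_eq_zero hd0 hκ tendsto_id hω

/-! ### The annealed partition function -/

/-- The mean of the partition function is the `n`-th power of the mean weight. -/
lemma integral_partition (hd : 0 < d) (hκ : 0 < κ) (n : ℕ) :
    ∫ ω, partition ω n ∂(fieldLaw ν) = meanWeight ν ^ n := by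
  have hb : ∀ n (ω : Field d κ), |partition ω n| ≤ (d : ℝ) ^ n := by
    intro n ω
    rw [abs_of_pos (partition_pos hd hκ ω n)]
    induction n with
    | zero => simp [partition_zero]
    | succ n ih =>
      rw [partition_succ_eq_mul_growth hd hκ, pow_succ]
      exact mul_le_mul ih (growth_le hd hκ ω ω n) (hκ.le.trans (le_growth hd hκ ω ω n))
        (by positivity)
  induction n with
  | zero => simp [partition_zero]
  | succ n ih =>
    rw [← integral_glue ν n (measurable_partition (n + 1)) (hb (n + 1))]
    have h1 : ∀ ω ω' : Field d κ, partition (glue n ω ω') (n + 1) =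
        partition ω n * growth ω ω' n := fun ω ω' => by
      rw [partition_succ_eq_mul_growth hd hκ,
        partition_congr fun x _ hx => glue_of_lt hx ω ω',
        growth_congr (fun x _ hx => glue_of_lt hx ω ω') fun x hx => glue_of_le hx.ge ω ω']
    simp only [h1, integral_const_mul, integral_growth ν hd hκ, integral_mul_const, ih, pow_succ]

/-! ### The quenched walk conditioned on the boundary as a directed polymer -/

lemma integral_stepMeasure (ω : Env d) (y : Site d) (g : Site d → ℝ) :
    ∫ z, g z ∂(stepMeasure ω y) = ∑ e : Dir d, prob ω y e * g (y + jump e) := by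
  have hint : ∀ e ∈ (Finset.univ : Finset (Dir d)), Integrable g
      (ENNReal.ofReal (prob ω y e) • Measure.dirac (y + jump e)) := fun e _ =>
    (integrable_dirac (by finiteness)).smul_measure ENNReal.ofReal_ne_top
  rw [stepMeasure, integral_finsetSum_measure hint]
  refine Finset.sum_congr rfl fun e _ => ?_
  rw [integral_smul_measure, integral_dirac, ENNReal.toReal_ofReal (show 0 ≤ prob ω y e from (ω y).2.1 e),
    smul_eq_mul]

/-- The Markov property of the quenched walk. -/
lemma integral_quenched_succ (ω : Env d) (x : Site d) (n : ℕ)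
    {F : (Π _ : Finset.Iic n, Site d) → ℝ} (hF : Measurable F) {g : Site d → ℝ} {B C : ℝ}
    (hB : ∀ h, |F h| ≤ B) (hC : ∀ z, |g z| ≤ C) :
    ∫ X, F (Preorder.frestrictLe n X) * g (X (n + 1)) ∂(quenched ω x) =
      ∫ X, F (Preorder.frestrictLe n X) * ∑ e : Dir d, prob ω (X n) e * g (X n + jump e)
        ∂(quenched ω x) := by
  have hg : Measurable g := measurable_of_countable g
  have hmeas : Measurable fun p : (Π _ : Finset.Iic n, Site d) × Site d => F p.1 * g p.2 :=
    (hF.comp measurable_fst).mul (hg.comp measurable_snd)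
  have hmap := Kernel.partialTraj_compProd_eq_map_traj (X := fun _ => Site d)
    (κ := histKernel ω) (Nat.zero_le n) (x₀ := fun _ => x)
  have hmap' := Kernel.traj_map_frestrictLe_apply (X := fun _ => Site d)
    (κ := histKernel ω) 0 n (fun _ => x)
  have hpair : Measurable fun X : ℕ → Site d =>
      (Preorder.frestrictLe (π := fun _ => Site d) n X, X (n + 1)) :=
    (Preorder.measurable_frestrictLe n).prodMk (measurable_pi_apply _)
  have hb : ∀ p : (Π _ : Finset.Iic n, Site d) × Site d, |F p.1 * g p.2| ≤ B * C := fun p => by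
    rw [abs_mul]
    exact mul_le_mul (hB _) (hC _) (abs_nonneg _) ((abs_nonneg _).trans (hB p.1))
  have hstep : Measurable fun z : Site d => ∑ e : Dir d, prob ω z e * g (z + jump e) :=
    measurable_of_countable _
  calc ∫ X, F (Preorder.frestrictLe n X) * g (X (n + 1)) ∂(quenched ω x)
      = ∫ p, F p.1 * g p.2 ∂((quenched ω x).map
          fun X => (Preorder.frestrictLe (π := fun _ => Site d) n X, X (n + 1))) := by
        rw [integral_map hpair.aemeasurable hmeas.aestronglyMeasurable]
    _ = ∫ p, F p.1 * g p.2 ∂((Kernel.partialTraj (X := fun _ => Site d) (histKernel ω) 0 n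
          (fun _ => x)) ⊗ₘ (histKernel ω n)) := by
        rw [hmap, quenched]
    _ = ∫ h, ∫ z, F h * g z ∂(histKernel ω n h)
          ∂(Kernel.partialTraj (X := fun _ => Site d) (histKernel ω) 0 n (fun _ => x)) := by
        rw [Measure.integral_compProd (integrable_of_abs_le hmeas hb)]
    _ = ∫ h, F h * ∑ e : Dir d, prob ω (h ⟨n, Finset.mem_Iic.mpr le_rfl⟩) e *
          g (h ⟨n, Finset.mem_Iic.mpr le_rfl⟩ + jump e)
          ∂(Kernel.partialTraj (X := fun _ => Site d) (histKernel ω) 0 n (fun _ => x)) := by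
        refine integral_congr_ae (ae_of_all _ fun h => ?_)
        dsimp only
        rw [integral_const_mul, ← integral_stepMeasure]
        rfl
    _ = _ := by
        rw [← hmap', integral_map (Preorder.measurable_frestrictLe n).aemeasurable]
        · rfl
        · exact (hF.mul (hstep.comp (measurable_pi_apply _))).aestronglyMeasurable

lemma ae_quenched_zero (ω : Env d) (x : Site d) : ∀ᵐ X ∂(quenched ω x), X 0 = x := by
  have hmap := Kernel.traj_map_frestrictLe_apply (X := fun _ => Site d)
    (κ := histKernel ω) 0 0 (fun _ => x)
  rw [Kernel.partialTraj_self, Kernel.id_apply] at hmap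
  have hm : Measurable fun h : (Π _ : Finset.Iic 0, Site d) => h ⟨0, by simp⟩ :=
    measurable_pi_apply _
  have h1 : ∀ᵐ h ∂(Measure.dirac (fun _ : Finset.Iic 0 => x)), h ⟨0, by simp⟩ = x := by
    exact (ae_dirac_iff (hm (measurableSet_singleton x))).mpr rfl
  rw [← hmap] at h1
  exact ae_of_ae_map (Preorder.measurable_frestrictLe 0).aemeasurable h1

lemma jump_one (i : Fin d) : jump (i, 1) = unitVec i := by
  simp [jump, unitVec]

lemma jump_neg_one (i : Fin d) : jump (i, -1) = -unitVec i := by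
  simp [jump, unitVec, Pi.single_neg]

lemma sum_dir (f : Dir d → ℝ) : ∑ e, f e = ∑ i, f (i, 1) + ∑ i, f (i, -1) := by
  rw [Fintype.sum_prod_type_right]
  rw [UnitsInt.univ,
    Finset.sum_pair (by decide : (1 : ℤˣ) ≠ -1)]

lemma prob_nonneg (ω : Env d) (x : Site d) (e : Dir d) : 0 ≤ prob ω x e := (ω x).2.1 e

lemma sum_prob (ω : Env d) (x : Site d) : ∑ e, prob ω x e = 1 := (ω x).2.2

lemma posWeight_le_one (ω : Env d) (x : Site d) : posWeight ω x ≤ 1 := by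
  have h := sum_prob ω x
  rw [sum_dir] at h
  have := Finset.sum_nonneg fun i (_ : i ∈ Finset.univ) => prob_nonneg ω x (i, -1)
  rw [posWeight]
  linarith

lemma abs_sum_prob_mul_le (ω : Env d) {g : Site d → ℝ} {C : ℝ} (hC : ∀ z, |g z| ≤ C)
    (x : Site d) : |∑ e : Dir d, prob ω x e * g (x + jump e)| ≤ C := by
  calc |∑ e : Dir d, prob ω x e * g (x + jump e)|
      ≤ ∑ e : Dir d, prob ω x e * C := by
        refine (Finset.abs_sum_le_sum_abs _ _).trans (Finset.sum_le_sum fun e _ => ?_)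
        rw [abs_mul, abs_of_nonneg (prob_nonneg ω x e)]
        exact mul_le_mul_of_nonneg_left (hC _) (prob_nonneg ω x e)
    _ = C := by rw [← Finset.sum_mul, sum_prob, one_mul]

/-- The walk reaches level `n` at time `n` along directed paths only. -/
lemma integral_quenched_eq_sum_mass {ω : Env d} {w : Field d κ}
    (hw : ∀ x i, (w x).1 i = prob ω x (i, 1)) (n : ℕ) {g : Site d → ℝ} {C : ℝ}
    (hC : ∀ z, |g z| ≤ C) (hg : ∀ z, level z < n → g z = 0) :
    ∫ X, g (X n) ∂(quenched ω 0) = ∑ x ∈ orthant d n, mass w n x * g x := by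
  induction n generalizing g with
  | zero =>
    have : (fun X : ℕ → Site d => g (X 0)) =ᵐ[quenched ω 0] fun _ => g 0 := by
      filter_upwards [ae_quenched_zero ω 0] with X hX
      rw [hX]
    rw [integral_congr_ae this]
    simp [mass]
  | succ n ih =>
    have h := integral_quenched_succ ω 0 n (F := fun _ => 1) measurable_const (B := 1)
      (fun _ => by simp) hC
    simp only [one_mul] at h
    rw [h, ih (g := fun z => ∑ e : Dir d, prob ω z e * g (z + jump e))
      (abs_sum_prob_mul_le ω hC), sum_mass_succ]
    · refine Finset.sum_congr rfl fun x hx => ?_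
      -- A negative jump from level n lands on level n - 1, below n + 1, where `g` vanishes.
      have hneg : ∀ i : Fin d, g (x + jump (i, -1)) = 0 := fun i => hg _ (by
        rw [jump_neg_one, ← sub_eq_add_neg, level_sub, level_unitVec, (mem_orthant.mp hx).2]
        push_cast
        omega)
      rw [sum_dir]
      simp only [hneg, mul_zero, Finset.sum_const_zero, add_zero, jump_one, hw]
    -- One jump from below level n cannot reach level n + 1, so the averaged test function again
    -- satisfies the vanishing condition.
    · intro z hz
      rw [sum_dir]
      have h1 : ∀ i : Fin d, g (z + jump (i, 1)) = 0 := fun i => hg _ (by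
        rw [jump_one, level_add, level_unitVec]
        push_cast
        omega)
      have h2 : ∀ i : Fin d, g (z + jump (i, -1)) = 0 := fun i => hg _ (by
        rw [jump_neg_one, ← sub_eq_add_neg, level_sub, level_unitVec]
        push_cast
        omega)
      simp [h1, h2]

lemma measureReal_quenched_eq_sum_mass {ω : Env d} {w : Field d κ}
    (hw : ∀ x i, (w x).1 i = prob ω x (i, 1)) (n : ℕ) (T : Set (Site d)) :
    (quenched ω 0).real (bdryEvent d n ∩ {X | X n ∈ T}) =
      ∑ x ∈ orthant d n, mass w n x * T.indicator 1 x := by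
  have hT : MeasurableSet {X : ℕ → Site d | X n ∈ bdry d n ∩ T} :=
    (measurable_pi_apply n) (Set.to_countable _).measurableSet
  have hae : (bdryEvent d n ∩ {X | X n ∈ T} : Set (ℕ → Site d)) =ᵐ[quenched ω 0]
      {X : ℕ → Site d | X n ∈ bdry d n ∩ T} := by
    filter_upwards [ae_quenched_zero ω 0] with X hX
    simp only [bdryEvent]
    refine propext ?_
    change (X n - X 0 ∈ bdry d n ∧ X n ∈ T) ↔ (X n ∈ bdry d n ∧ X n ∈ T)
    rw [hX, sub_zero]
  rw [measureReal_congr hae, ← integral_indicator_one hT]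
  have h := integral_quenched_eq_sum_mass hw n (g := (bdry d n ∩ T).indicator 1) (C := 1)
    (fun z => by
      by_cases hz : z ∈ bdry d n ∩ T <;> simp [hz, Set.indicator])
    (fun z hz => Set.indicator_of_notMem (fun hz' => by
      have := (mem_orthant.mp (mem_orthant_iff_mem_bdry.mpr hz'.1)).2
      omega) _)
  refine Eq.trans ?_ (h.trans (Finset.sum_congr rfl fun x hx => ?_))
  · rfl
  · have hx' := mem_orthant_iff_mem_bdry.mp hx
    by_cases hxT : x ∈ T <;> simp [Set.indicator, hx', hxT]

lemma cond_quenched_eq_endpoint {ω : Env d} {w : Field d κ}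
    (hw : ∀ x i, (w x).1 i = prob ω x (i, 1)) (n : ℕ) (x : Site d) :
    (cond (quenched ω 0) (bdryEvent d n)).real {X | X n = x} = endpoint w n x := by
  have hm : MeasurableSet (bdryEvent d n) :=
    ((measurable_pi_apply n).sub (measurable_pi_apply 0)) (Set.to_countable _).measurableSet
  rw [measureReal_def, cond_apply hm, ENNReal.toReal_mul, ENNReal.toReal_inv,
    ← measureReal_def, ← measureReal_def]
  have h1 := measureReal_quenched_eq_sum_mass hw n Set.univ
  have h2 := measureReal_quenched_eq_sum_mass hw n {x}
  simp only [Set.mem_univ, Set.ofPred_true, Set.inter_univ, Set.indicator_univ, Pi.one_apply,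
    mul_one] at h1
  simp only [Set.mem_singleton_iff] at h2
  rw [h1, h2, endpoint, partition, div_eq_inv_mul]
  congr 1
  by_cases hx : x ∈ orthant d n
  · rw [Finset.sum_eq_single_of_mem x hx fun y _ hy => by simp [hy]]
    simp
  · rw [mass_eq_zero w hx]
    refine Finset.sum_eq_zero fun y hy => ?_
    have : y ≠ x := fun h => hx (h ▸ hy)
    simp [this]

lemma maxEndpoint_zero (hd : 0 < d) (hκ : 0 < κ) (w : Field d κ) : maxEndpoint w 0 = 1 := by
  refine le_antisymm (maxEndpoint_le_one hd hκ w 0) ?_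
  have h := endpoint_le_maxEndpoint hd hκ w 0 0
  simpa [endpoint, mass, partition_zero] using h

/-- J_{n+1} looks at time n. The convention J_1 = 1 agrees with the polymer of length 0, whose
endpoint is the origin. -/
lemma J_succ_eq_maxEndpoint (hd : 0 < d) (hκ : 0 < κ) {ω : Env d} {w : Field d κ}
    (hw : ∀ x i, (w x).1 i = prob ω x (i, 1)) (n : ℕ) : J ω (n + 1) = maxEndpoint w n := by
  rcases Nat.eq_zero_or_pos n with rfl | hn
  · rw [maxEndpoint_zero hd hκ]
    simp [J]
  · rw [J, if_neg (by omega), maxEndpoint]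
    exact iSup_congr fun x => cond_quenched_eq_endpoint hw n x

lemma liminfJ_eq (hd : 0 < d) (hκ : 0 < κ) {ω : Env d} {w : Field d κ}
    (hw : ∀ x i, (w x).1 i = prob ω x (i, 1)) :
    liminfJ ω = liminf (avgMaxEndpoint w) atTop := by
  have hsum : ∀ n, ∑ k ∈ Finset.Icc 1 n, J ω k = ∑ k ∈ Finset.range n, maxEndpoint w k := by
    intro n
    induction n with
    | zero => simp
    | succ n ih =>
      rw [Finset.sum_Icc_succ_top (by omega), ih, Finset.sum_range_succ,
        J_succ_eq_maxEndpoint hd hκ hw]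
  rw [liminfJ]
  congr 1
  funext n
  rw [hsum, avgMaxEndpoint, one_div_mul_eq_div]

/-- The Feynman–Kac representation of the directed polymer. -/
lemma integral_exp_mul_eq_sum_mass {ω : Env d} {w : Field d κ} (hpos : ∀ x, 0 < posWeight ω x)
    (hw : ∀ x i, (w x).1 i = prob ω x (i, 1)) (n : ℕ) {g : Site d → ℝ} {C : ℝ}
    (hC : ∀ z, |g z| ≤ C) :
    ∫ X, Real.exp (∑ i ∈ Finset.range n, Psi ω (X i)) * g (X n) ∂(quenched (piEnv ω) 0) =
      ∑ x ∈ orthant d n, mass w n x * g x := by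
  have hPsi : ∀ x, Psi ω x ≤ 0 := fun x => Real.log_nonpos (hpos x).le (posWeight_le_one ω x)
  induction n generalizing g C with
  | zero =>
    have : (fun X : ℕ → Site d => Real.exp (∑ i ∈ Finset.range 0, Psi ω (X i)) * g (X 0))
        =ᵐ[quenched (piEnv ω) 0] fun _ => g 0 := by
      filter_upwards [ae_quenched_zero (piEnv ω) 0] with X hX
      simp [hX]
    rw [integral_congr_ae this]
    simp [mass]
  | succ n ih =>
    -- The exponential weight as a function of the history up to time n, so that the Markov property
    -- applies; the default value 0 is never used, as i ≤ n in the sum.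
    let F : (Π _ : Finset.Iic n, Site d) → ℝ := fun h =>
      Real.exp (∑ i ∈ Finset.range (n + 1),
        Psi ω (if hi : i ≤ n then h ⟨i, Finset.mem_Iic.mpr hi⟩ else 0))
    have hF : ∀ X : ℕ → Site d, F (Preorder.frestrictLe n X) =
        Real.exp (∑ i ∈ Finset.range (n + 1), Psi ω (X i)) := fun X => by
      refine congrArg Real.exp (Finset.sum_congr rfl fun i hi => ?_)
      rw [dif_pos (Nat.lt_succ_iff.mp (Finset.mem_range.mp hi))]
      rfl
    have hFm : Measurable F := measurable_of_countable F
    have hFb : ∀ h, |F h| ≤ 1 := fun h => by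
      rw [Real.abs_exp, Real.exp_le_one_iff]
      exact Finset.sum_nonpos fun i _ => hPsi _
    have h := integral_quenched_succ (piEnv ω) 0 n hFm hFb hC
    simp only [hF] at h
    -- The factor e^Ψ cancels the normalization of π and restores the original weights.
    have hstep : ∀ x, Real.exp (Psi ω x) * ∑ e : Dir d, prob (piEnv ω) x e * g (x + jump e) =
        ∑ i, (w x).1 i * g (x + unitVec i) := by
      intro x
      have hprob : ∀ e : Dir d, prob (piEnv ω) x e =
          if e.2 = 1 then prob ω x e / posWeight ω x else 0 := fun e => by
        have : piEnv ω x = _ := dif_pos (hpos x)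
        rw [prob, this]
        rfl
      have hne : (-1 : ℤˣ) ≠ 1 := by decide
      rw [sum_dir, Psi, Real.exp_log (hpos x)]
      simp only [hprob, if_true, hne, if_false, zero_mul, Finset.sum_const_zero, add_zero,
        jump_one, hw, Finset.mul_sum]
      refine Finset.sum_congr rfl fun i _ => ?_
      have := (hpos x).ne'
      field_simp
    have hb : ∀ x, |∑ i, (w x).1 i * g (x + unitVec i)| ≤ C := fun x => by
      rw [← hstep, abs_mul, Real.abs_exp]
      refine (mul_le_of_le_one_left (abs_nonneg _) (Real.exp_le_one_iff.mpr (hPsi x))).trans ?_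
      exact abs_sum_prob_mul_le (piEnv ω) hC x
    rw [h, sum_mass_succ, ← ih (g := fun x => ∑ i, (w x).1 i * g (x + unitVec i)) hb]
    refine integral_congr_ae (ae_of_all _ fun X => ?_)
    dsimp only
    rw [Finset.sum_range_succ, Real.exp_add, mul_assoc, hstep]

lemma Z_eq_partition {ω : Env d} {w : Field d κ} (hpos : ∀ x, 0 < posWeight ω x)
    (hw : ∀ x i, (w x).1 i = prob ω x (i, 1)) (n : ℕ) : Z ω n = partition w n := by
  have h := integral_exp_mul_eq_sum_mass hpos hw n (g := fun _ => 1) (C := 1) (fun _ => by simp)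
  simpa [Z, partition] using h

/-! ### Truncation to an i.i.d. field with everywhere bounded weights -/

/-- The probabilities of the positive jumps, truncated from below at `κ`. -/
def clip (hκ : κ ≤ 1) (v : ProbVec d) : WeightVec d κ :=
  ⟨fun i => max κ ((v : Dir d → ℝ) (i, 1)), fun i => ⟨le_max_left _ _, max_le hκ (by
    rw [← v.2.2]
    exact Finset.single_le_sum (f := (v : Dir d → ℝ)) (fun e _ => v.2.1 e)
      (Finset.mem_univ (i, 1)))⟩⟩

lemma measurable_clip (hκ : κ ≤ 1) : Measurable (clip hκ : ProbVec d → WeightVec d κ) := by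
  refine Measurable.subtype_mk (measurable_pi_iff.mpr fun i => measurable_const.max ?_)
  exact (measurable_pi_apply (i, (1 : ℤˣ))).comp measurable_subtype_coe

/-- The field of truncated jump probabilities. -/
def clipField (hκ : κ ≤ 1) (ω : Env d) : Field d κ := fun x => clip hκ (ω x)

lemma measurable_clip_eval (hκ : κ ≤ 1) (x : Site d) :
    Measurable fun ω : Env d => clip hκ (ω x) :=
  (measurable_clip hκ).comp (measurable_pi_apply x)

lemma measurable_clipField (hκ : κ ≤ 1) : Measurable (clipField hκ : Env d → Field d κ) :=
  measurable_pi_iff.mpr (measurable_clip_eval hκ)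

lemma clipField_apply (hκ : κ ≤ 1) {ω : Env d} (h : ∀ x e, κ ≤ prob ω x e) (x : Site d)
    (i : Fin d) : (clipField hκ ω x).1 i = prob ω x (i, 1) :=
  max_eq_right (h x (i, 1))

/-- The marginal law of the truncated jump probabilities. -/
abbrev clipLaw (hκ : κ ≤ 1) (μ : Measure (Env d)) : Measure (WeightVec d κ) :=
  μ.map fun ω => clip hκ (ω 0)

instance (hκ : κ ≤ 1) (μ : Measure (Env d)) [IsProbabilityMeasure μ] :
    IsProbabilityMeasure (clipLaw hκ μ) :=
  Measure.isProbabilityMeasure_map (measurable_clip_eval hκ 0).aemeasurable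

/-- Truncation acts site by site, so it preserves independence and the common law; almost sure
statements about the product law then pull back to `μ`. -/
lemma map_clipField (hκ : κ ≤ 1) {μ : Measure (Env d)} [IsProbabilityMeasure μ]
    (hiid : IsIID μ) : μ.map (clipField hκ) = fieldLaw (clipLaw hκ μ) := by
  have hind := hiid.1.comp (fun _ => clip hκ) fun _ => measurable_clip hκ
  have h := hind.map_fun_eq_infinitePi_map (measurable_clip_eval hκ)
  have hlaw : (fun x : Site d => μ.map (fun ω : Env d => clip hκ (ω x))) =
      fun _ => clipLaw hκ μ :=
    funext fun x => ((hiid.2 x 0).comp (measurable_clip hκ)).map_eq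
  rw [hlaw] at h
  exact h

end RWRE

end

/-! ### Assembly of the theorem -/

theorem theorem2p1 (d : ℕ) (hd : 2 ≤ d)
    (μ : MeasureTheory.Measure (RWRE.Env d)) [MeasureTheory.IsProbabilityMeasure μ]
    (hiid : RWRE.IsIID μ) (hell : RWRE.UniformlyElliptic μ) :
    ∃ p l : ℝ, RWRE.IsQuenchedFreeEnergy μ p ∧ RWRE.IsAnnealedFreeEnergy μ l ∧
      l = Real.log (RWRE.c μ) ∧
      (RWRE.Localized μ ↔ p < l) ∧
      (RWRE.Delocalized μ ↔ p = l) ∧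
      Xor (RWRE.Localized μ) (RWRE.Delocalized μ) := by
  open RWRE MeasureTheory Filter Topology in
  obtain ⟨κ, hκ0, hκ⟩ := hell
  have hd0 : 0 < d := by omega
  have hae : ∀ᵐ ω ∂μ, ∀ x e, κ ≤ prob ω x e := by
    simp only [ae_all_iff]
    exact hκ
  have hκ1 : κ ≤ 1 := by
    obtain ⟨ω, hω⟩ := hae.exists
    refine (hω 0 (⟨0, hd0⟩, 1)).trans ?_
    rw [← sum_prob ω 0]
    exact Finset.single_le_sum (fun e _ => prob_nonneg ω 0 e) (Finset.mem_univ _)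
  have hw : ∀ᵐ ω ∂μ, ∀ x i, (clipField hκ1 ω x).1 i = prob ω x (i, 1) := by
    filter_upwards [hae] with ω hω using clipField_apply hκ1 hω
  have hpos : ∀ᵐ ω ∂μ, ∀ x, 0 < posWeight ω x := by
    filter_upwards [hae] with ω hω x
    exact Finset.sum_pos (fun i _ => hκ0.trans_le (hω x (i, 1))) ⟨⟨0, hd0⟩, Finset.mem_univ _⟩
  have hZ : ∀ᵐ ω ∂μ, ∀ n, Z ω n = partition (clipField hκ1 ω) n := by
    filter_upwards [hw, hpos] with ω h1 h2 n using Z_eq_partition h2 h1 n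
  set ν := clipLaw hκ1 μ with hν
  have hmap := map_clipField hκ1 hiid
  have htransfer : ∀ {P : Field d κ → Prop}, (∀ᵐ w ∂(fieldLaw ν), P w) →
      ∀ᵐ ω ∂μ, P (clipField hκ1 ω) := fun h =>
    ae_of_ae_map (measurable_clipField hκ1).aemeasurable (hmap.symm ▸ h)
  have hc : meanWeight ν = c μ := by
    rw [meanWeight, hν, integral_map (measurable_clip_eval hκ1 0).aemeasurable
      measurable_rowSum.aestronglyMeasurable]
    have h1 : (fun ω => rowSum (clip hκ1 (ω 0))) =ᵐ[μ] fun ω => ∑ i, prob ω 0 (i, 1) := by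
      filter_upwards [hw] with ω hω
      exact Finset.sum_congr rfl fun i _ => hω 0 i
    have hmeas : ∀ e : Dir d, Measurable fun ω : Env d => prob ω 0 e := fun e =>
      (measurable_pi_apply e).comp (measurable_subtype_coe.comp (measurable_pi_apply 0))
    rw [integral_congr_ae h1, integral_finsetSum]
    · rfl
    · intro i _
      refine integrable_of_abs_le (hmeas _) (C := 1) fun ω => ?_
      rw [abs_of_nonneg (prob_nonneg ω 0 _), ← sum_prob ω 0]
      exact Finset.single_le_sum (fun e _ => prob_nonneg ω 0 e) (Finset.mem_univ _)
  obtain ⟨p, hp⟩ := exists_freeEnergy ν hd0 hκ0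
  have hle : p ≤ Real.log (c μ) := hc ▸ freeEnergy_le ν hd0 hκ0 hp
  have hloc : p < Real.log (c μ) → Localized μ := fun hlt => by
    filter_upwards [hw, htransfer (ae_liminf_avgMaxEndpoint_pos ν hd0 hκ0 hp (hc ▸ hlt))]
      with ω h1 h2
    rwa [liminfJ_eq hd0 hκ0 h1]
  have hdeloc : p = Real.log (c μ) → Delocalized μ := fun heq => by
    rw [heq, ← hc] at hp
    filter_upwards [hw, htransfer (ae_liminf_avgMaxEndpoint_eq_zero ν hd hκ0 hp)] with ω h1 h2
    rwa [liminfJ_eq hd0 hκ0 h1]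
  -- Under a probability measure two almost sure events share a point, where the liminf would be
  -- both positive and zero.
  have hexcl : Localized μ → Delocalized μ → False := fun h1 h2 => by
    obtain ⟨ω, h3, h4⟩ := (h1.and h2).exists
    exact h3.ne' h4
  have hcases : p < Real.log (c μ) ∨ p = Real.log (c μ) := hle.lt_or_eq
  refine ⟨p, Real.log (c μ), ?_, ?_, rfl, ⟨fun h => ?_, hloc⟩, ⟨fun h => ?_, hdeloc⟩, ?_⟩
  · filter_upwards [hZ, htransfer hp] with ω h1 h2
    refine h2.congr fun n => ?_
    rw [h1, one_div_mul_eq_div]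
  · have hEZ : ∀ n, ∫ ω, Z ω n ∂μ = c μ ^ n := fun n => by
      have h1 : (fun ω => Z ω n) =ᵐ[μ] fun ω => partition (clipField hκ1 ω) n := by
        filter_upwards [hZ] with ω h using h n
      rw [integral_congr_ae h1, ← hc, ← integral_partition ν hd0 hκ0, ← hmap,
        integral_map (measurable_clipField hκ1).aemeasurable
          (measurable_partition n).aestronglyMeasurable]
    refine tendsto_const_nhds.congr' ?_
    -- Since the mean is c^n, the sequence equals log c for every n ≥ 1; at n = 0 the factor 1/n is
    -- 0 by convention.
    filter_upwards [eventually_ge_atTop 1] with n hn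
    have hn' : (n : ℝ) ≠ 0 := by positivity
    rw [hEZ, Real.log_pow, one_div, inv_mul_cancel_left₀ hn']
  · exact hcases.resolve_right fun heq => hexcl h (hdeloc heq)
  · exact hcases.resolve_left fun hlt => hexcl (hloc hlt) h
  · rcases hcases with hlt | heq
    · exact Or.inl ⟨hloc hlt, hexcl (hloc hlt)⟩
    · exact Or.inr ⟨hdeloc heq, fun h => hexcl h (hdeloc heq)⟩
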